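/- Let $0\le l\le k$ be integers. A configuration is a sequence $\mathbf a=(a_i)_{i\in\mathbb Z}$ of non-negative integers with finitely many nonzero terms. Put $|\mathbf a|=\sum_i a_i$, $S[i,\mathbf a]=a_i+a_{i+1}$ and $L[i,\mathbf a]=a_{i-1}+2a_i+2a_{i+1}+a_{i+2}$. Let $C^{(k)}$ be the set of configurations with $a_i+a_{i+1}+a_{i+2}\le k$ for all $i$, let $C^{(k,l)}$ be the set of $\mathbf a\in C^{(k)}$ with $S[i,\mathbf a]\le l$ and $L[i,\mathbf a]\le k+l$ for all $i$, let $C^{(k,l)}_{\rm pos}$ be the set of $\mathbf a\in C^{(k,l)}$ with $a_i=0$ for all $i<0$, and, for an integer $N$, let $C^{(k,l)}_{\rm pos}[N]$ be the set of $\mathbf a\in C^{(k,l)}_{\rm pos}$ with $a_i=0$ for all $i>N$. Put $A_{p,q}=2\min(p,q)+\max(p+q-k,0)$. To each $\mathbf a\in C^{(k)}$ one associates a rigged partition $\iota(\mathbf a)=(\lambda,\rho)$, where $\lambda=(\lambda_1,\dots,\lambda_n)$ and $\rho=(\rho_1,\dots,\rho_n)$, by recursion on $|\mathbf a|$. If $\mathbf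 a=\mathbf 0$, then $n=0$. Otherwise let $\lambda_1$ be the least $p$ with $\mathbf a\in C^{(k,p)}$. For a nonzero $\mathbf b\in C^{(k)}$ whose least such $p$ is $p_{\mathbf b}$, its highest position is the largest $i$ with $S[i,\mathbf b]=p_{\mathbf b}$ or $L[i,\mathbf b]=k+p_{\mathbf b}$, and the right move $M_+\mathbf b$ is obtained from $\mathbf b$ by decreasing $b_i$ by $1$ and increasing $b_{i+1}$ by $1$ at this $i$. Let $i_0$ be the integer with $a_{i_0-1}\ne0$ and $a_j=0$ for all $j\ge i_0$, let $t_0\ge 0$ be the number of right moves, starting from $\mathbf a$, before the first one after which this condition on $i_0$ fails, put $\mathbf b=M_+^{t_0}\mathbf a$, let $i$ be the highest position of $\mathbf b$, and put $s_1=ib_i+(i+1)b_{i+1}-t_0$. Let $\overline{\mathbf a}$ be given by $\overline a_j=b_j$ for $j\le i_0-2$ and $\overline a_j=0$ otherwise. With $\iota(\overline{\mathbf a})=((\lambda_2,\dots,\lambda_n),(\rho_2,\dots,\rho_n))$, put $\rho_1=s_1-\sum_{j=2}^nA_{\lambda_1,\lambda_j}$. **Theorem.** Let $\mathbf a\in C^{(k,l)}_{\rm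 pos}$ and $N\in\mathbb Z$, and let $(\lambda,\rho)=\iota(\mathbf a)$ with $\lambda=(\lambda_1,\dots,\lambda_n)$. Then $\mathbf a\in C^{(k,l)}_{\rm pos}[N]$ (that is, $a_i=0$ for all $i>N$) if and only if $$\rho_i\le\lambda_iN-\sum_{j\ne i}A_{\lambda_i,\lambda_j}\qquad\text{for all }1\le i\le n.$$ -/

import Mathlib

namespace Conf

/-- A finite configuration: a sequence `(a_i)` of non-negative integers indexed by the integers,
with finitely many nonzero terms. -/
abbrev Configuration := ℤ →₀ ℕ

/-- The length `|a| = ∑ a_i`. -/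
def size (a : Configuration) : ℕ := a.sum fun _ n => n

/-- `S[i, a] = a_i + a_{i+1}`. -/
def S (a : Configuration) (i : ℤ) : ℕ := a i + a (i + 1)

/-- `L[i, a] = a_{i-1} + 2 a_i + 2 a_{i+1} + a_{i+2}`. -/
def L (a : Configuration) (i : ℤ) : ℕ := a (i - 1) + 2 * a i + 2 * a (i + 1) + a (i + 2)

/-- The set `C^{(k)}` of finite `(k,3)`-admissible configurations. -/
def Adm (k : ℕ) : Set Configuration := {a | ∀ i, a i + a (i + 1) + a (i + 2) ≤ k}

/-- The set `C^{(k,l)}` of the elements of `C^{(k)}` of maximal weight at most `l`. -/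
def C (k l : ℕ) : Set Configuration := {a | a ∈ Adm k ∧ ∀ i, S a i ≤ l ∧ L a i ≤ k + l}

/-- The positively supported elements of `C^{(k,l)}`. -/
def Cpos (k l : ℕ) : Set Configuration := {a | a ∈ C k l ∧ ∀ i < 0, a i = 0}

/-- The positively supported elements of `C^{(k,l)}` that vanish above `N`. -/
def CposUpTo (k l : ℕ) (N : ℤ) : Set Configuration := {a | a ∈ Cpos k l ∧ ∀ i, N < i → a i = 0}

/-- The least `l` with `a ∈ C^{(k,l)}`. It exists and is at most `k` for `a ∈ C^{(k)}`. -/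
noncomputable def weight (k : ℕ) (a : Configuration) : ℕ := sInf {l | a ∈ C k l}

/-- The highest position of a particle of weight `l = weight k a`: the largest `i` with
`S[i, a] = l` or `L[i, a] = k + l`. It exists for nonzero `a ∈ C^{(k)}`. -/
noncomputable def highest (k : ℕ) (a : Configuration) : ℤ :=
  sSup {i | S a i = weight k a ∨ L a i = k + weight k a}

/-- The right move `M_+`: it takes one unit from the column `i = highest k a` (which is occupied
if `a ∈ C^{(k)}` is nonzero) to the column `i + 1`. -/
noncomputable def rightMove (k : ℕ) (a : Configuration) : Configuration :=
  a - Finsupp.single (highest k a) 1 + Finsupp.single (highest k a + 1) 1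

/-- `a_{i-1} ≠ 0` and `a_j = 0` for all `j ≥ i`. -/
def EndsAt (a : Configuration) (i : ℤ) : Prop := a (i - 1) ≠ 0 ∧ ∀ j, i ≤ j → a j = 0

/-- The integer `i_0` with `EndsAt a i_0`, for nonzero `a`. -/
noncomputable def endpoint (a : Configuration) : ℤ := sSup {i | a i ≠ 0} + 1

/-- The number `t_0` such that the end point `i_0` of `a` is kept by the first `t_0` right moves,
and the condition breaks down in the move from `M_+^{t_0} a` to `M_+^{t_0 + 1} a`. -/
noncomputable def breakTime (k : ℕ) (a : Configuration) : ℕ :=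
  sInf {t | ¬ EndsAt ((rightMove k)^[t + 1] a) (endpoint a)}

/-- The configuration `M_+^{t_0} a`, which contains a free particle. -/
noncomputable def freed (k : ℕ) (a : Configuration) : Configuration :=
  (rightMove k)^[breakTime k a] a

/-- The energy `d = i b_i + (i + 1) b_{i+1}` of the free particle of a configuration `b`,
where `i` is its highest position. -/
noncomputable def freeEnergy (k : ℕ) (b : Configuration) : ℤ :=
  highest k b * b (highest k b) + (highest k b + 1) * b (highest k b + 1)

/-- The number `s = d - t_0`. -/
noncomputable def shift (k : ℕ) (a : Configuration) : ℤ :=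
  freeEnergy k (freed k a) - breakTime k a

/-- The configuration obtained from `M_+^{t_0} a` by removing the free particle: the columns
`i ≤ i_0 - 2` are kept and all others are emptied. -/
noncomputable def removeParticle (k : ℕ) (a : Configuration) : Configuration :=
  (freed k a).filter fun i => i ≤ endpoint a - 2

/-- `A_{l,l'} = 2 min(l,l') + max(l + l' - k, 0)`. -/
def A (k l l' : ℕ) : ℤ := 2 * min (l : ℤ) l' + max ((l : ℤ) + l' - k) 0

/-- The particle content and rigging, as the list of the pairs `(λ_1, ρ_1), …, (λ_n, ρ_n)`,
computed with at most `n` removals of a particle. -/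
noncomputable def iotaAux (k : ℕ) : ℕ → Configuration → List (ℕ × ℤ)
  | 0, _ => []
  | n + 1, a =>
    if a = 0 then []
    else
      let R := iotaAux k n (removeParticle k a)
      (weight k a, shift k a - (R.map fun p => A k (weight k a) p.1).sum) :: R

/-- The map `ι` sending `a` to its rigged partition `(λ_1, ρ_1), …, (λ_n, ρ_n)`. Each removal of a
particle decreases the length of the configuration, so that `|a|` removals exhaust it. -/
noncomputable def iota (k : ℕ) (a : Configuration) : List (ℕ × ℤ) := iotaAux k (size a) a

/-- The number `n` of parts of the rigged partition of `a`. -/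
noncomputable def numParts (k : ℕ) (a : Configuration) : ℕ := (iota k a).length

/-- The part `λ_i` of the particle content of `a` (with indices starting at `0`). -/
noncomputable def part (k : ℕ) (a : Configuration) (i : Fin (numParts k a)) : ℕ :=
  ((iota k a).get i).1

/-- The rigging `ρ_i` of the part `λ_i`. -/
noncomputable def rigging (k : ℕ) (a : Configuration) (i : Fin (numParts k a)) : ℤ :=
  ((iota k a).get i).2

end Conf

namespace Conf

/-! ### Weights, highest positions and right moves. -/

section

variable {k p q : ℕ} {a b c d : Configuration} {u : ℤ → ℤ} {i : ℤ}

/-! The proof is an induction on the number of parts. Let `q` be the weight of `a` and `c` what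
remains once its highest particle is removed. Send a particle of weight `q` from the far right
through `c` to the far left, and let `d` be the configuration that it leaves behind (`Pass`). The
induction hypothesis is applied to `d`, not to `c`, and rests on two facts.

First (`IsHighest.vanishing_iff`): `a` vanishes above `N` if and only if `s₁ ≤ q N` and `d` vanishes
above `N`. Undoing the right moves that freed the particle, one follows it leftwards through `c`. So
`a` is a snapshot of the passage: it agrees with `c` left of some column and with `d` on the right,
while the particle sits in between, and `s₁` tells how far the passage has got (`Pass.occurs`).

Second (`Pass.iota_eq`): `d` has the parts of `c`, and the rigging of a part `λ_j` is larger by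
`A_{q,λ_j}`. The passage commutes with the right moves of the lighter configuration
(`Pass.exists_rightMove`), so the highest particle of `c` may be moved far away first. There the
collision of two particles is computed explicitly (`Pass.add_withParticle`), and its energy shift is
`A_{q,λ_j}`.

As `ρ₁ + ∑_{j≥2} A_{q,λ_j} = s₁`, the condition on `s₁` is the bound for the first part; the bounds
for `d` are those for the other parts, with the term `A_{λ_j,q}` coming from the shifted rigging. -/

theorem L_eq (a : Configuration) (i : ℤ) : L a i = S a (i - 1) + S a i + S a (i + 1) := by
  simp only [L, S, sub_add_cancel, show i + 1 + 1 = i + 2 by ring]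
  ring

theorem C_mono (h : p ≤ q) : C k p ⊆ C k q := fun a ha =>
  ⟨ha.1, fun i => ⟨(ha.2 i).1.trans h, (ha.2 i).2.trans (by omega)⟩⟩

theorem mem_C_self (ha : a ∈ Adm k) : a ∈ C k k := by
  refine ⟨ha, fun i => ?_⟩
  have h1 := ha i
  have h2 := ha (i - 1)
  simp only [sub_add_cancel, show i - 1 + 2 = i + 1 by ring] at h2
  simp only [S, L]
  omega

theorem eventually_zero (a : Configuration) : ∃ B : ℤ, ∀ x, B ≤ x → a x = 0 := by
  obtain ⟨B, hB⟩ := a.support.bddAbove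
  refine ⟨B + 1, fun x hx => ?_⟩
  by_contra h
  have := hB (Finset.mem_coe.2 (Finsupp.mem_support_iff.2 h))
  omega

theorem eventually_zero_left (a : Configuration) : ∃ B : ℤ, ∀ x, x ≤ B → a x = 0 := by
  obtain ⟨B, hB⟩ := a.support.bddBelow
  refine ⟨B - 1, fun x hx => ?_⟩
  by_contra h
  have := hB (Finset.mem_coe.2 (Finsupp.mem_support_iff.2 h))
  omega

/-- `a` has weight `q`, and `i` is its highest position. -/
structure IsHighest (k q : ℕ) (a : Configuration) (i : ℤ) : Prop where
  mem : a ∈ C k q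
  tight : S a i = q ∨ L a i = k + q
  lt : ∀ j, i < j → S a j < q ∧ L a j < k + q

theorem IsHighest.weight_eq (h : IsHighest k q a i) : weight k a = q := by
  refine le_antisymm (Nat.sInf_le h.mem) ?_
  refine le_csInf ⟨q, h.mem⟩ fun l hl => ?_
  have := hl.2 i
  rcases h.tight with h | h <;> omega

theorem IsHighest.highest_eq (h : IsHighest k q a i) : highest k a = i := by
  refine IsGreatest.csSup_eq ⟨?_, fun j hj => ?_⟩
  · simpa only [Set.mem_ofPred_eq, h.weight_eq] using h.tight
  · simp only [Set.mem_ofPred_eq, h.weight_eq] at hj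
    by_contra hij
    have := h.lt j (by omega)
    omega

theorem IsHighest.pos (h : IsHighest k q a i) : 0 < q := by
  have := h.lt (i + 1) (by omega)
  omega

theorem IsHighest.le (h : IsHighest k q a i) : q ≤ k := by
  have := (mem_C_self h.mem.1).2 i
  rcases h.tight with h | h <;> omega

theorem IsHighest.ne_zero (h : IsHighest k q a i) : a ≠ 0 := by
  rintro rfl
  have := h.pos
  have := h.tight
  simp [S, L] at this
  omega

theorem exists_isHighest (ha : a ∈ Adm k) (h0 : a ≠ 0) : ∃ q i, IsHighest k q a i := by
  have hmem : a ∈ C k (weight k a) := Nat.sInf_mem (s := {l | a ∈ C k l}) ⟨k, mem_C_self ha⟩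
  have hpos : 0 < weight k a := by
    by_contra hq
    refine h0 (Finsupp.ext fun x => ?_)
    have := (hmem.2 x).1
    simp only [S] at this
    simp only [Finsupp.coe_zero, Pi.zero_apply]
    omega
  have hex : ∃ i, S a i = weight k a ∨ L a i = k + weight k a := by
    by_contra hne
    push Not at hne
    have : weight k a ≤ weight k a - 1 := Nat.sInf_le (s := {l | a ∈ C k l}) ⟨ha, fun i => by
      have h1 := hmem.2 i
      have h2 := hne i
      omega⟩
    omega
  obtain ⟨B, hB⟩ := eventually_zero a
  obtain ⟨i, hi, hmax⟩ := Int.exists_greatest_of_bdd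
    (P := fun i => S a i = weight k a ∨ L a i = k + weight k a) ⟨B, fun z hz => by
      by_contra hlt
      have e1 := hB z (by omega)
      have e2 := hB (z + 1) (by omega)
      have e3 := hB (z - 1) (by omega)
      have e4 := hB (z + 2) (by omega)
      simp only [S, L] at hz
      omega⟩ hex
  refine ⟨_, i, hmem, hi, fun j hj => ?_⟩
  have h1 := hmem.2 j
  have h2 := mt (hmax j) (by omega)
  omega

/-- `b` is obtained from `a` by taking one unit from the column `i` to the column `i + 1`. -/
def Step (a : Configuration) (i : ℤ) (b : Configuration) : Prop :=
  ∀ y, (b y : ℤ) = a y + (if y = i + 1 then 1 else 0) - (if y = i then 1 else 0)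

theorem Step.S_eq (h : Step a i b) (j : ℤ) :
    (S b j : ℤ) = S a j + (if j = i + 1 then 1 else 0) - (if j = i - 1 then 1 else 0) := by
  have h1 := h j
  have h2 := h (j + 1)
  simp only [S, Nat.cast_add, h1, h2]
  split_ifs <;> omega

theorem Step.L_eq (h : Step a i b) (j : ℤ) :
    (L b j : ℤ) = L a j + (if j = i + 1 ∨ j = i + 2 then 1 else 0)
      - (if j = i - 1 ∨ j = i - 2 then 1 else 0) := by
  have h1 := h.S_eq j
  have h2 := h.S_eq (j + 1)
  have h3 := h.S_eq (j - 1)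
  simp only [Conf.L_eq, Nat.cast_add, h1, h2, h3]
  split_ifs <;> omega

theorem Step.unique (h : Step a i b) (h' : Step a i c) : b = c := by
  ext y
  have := h y
  have := h' y
  omega

/-- If the column `i` were empty, tightness at `i` together with admissibility at `i - 1` would
force `S a (i + 1) ≥ q`, against the maximality of `i`. -/
theorem IsHighest.apply_pos (h : IsHighest k q a i) : 0 < a i := by
  have h1 := h.lt (i + 1) (by omega)
  have h2 := h.mem.1 (i - 1)
  have h3 := h.tight
  simp only [S, L, add_sub_cancel_right, sub_add_cancel, show i + 1 + 1 = i + 2 by ring,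
    show i - 1 + 2 = i + 1 by ring] at *
  omega

theorem IsHighest.step (h : IsHighest k q a i) : Step a i (rightMove k a) := by
  intro y
  have hp := h.apply_pos
  simp only [rightMove, h.highest_eq, Finsupp.add_apply, Finsupp.tsub_apply, Finsupp.single_apply]
  by_cases h1 : y = i
  · subst h1
    simp
    omega
  · by_cases h2 : y = i + 1
    · subst h2
      simp
    · simp [Ne.symm h1, Ne.symm h2, h1, h2]

/-- The move raises `S` only at `i + 1` and `L` only at `i + 1` and `i + 2`, by one each, and there
the bounds are strict because `i` is highest. Among the sums of three columns only the one starting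
at `i + 1` grows. -/
theorem IsHighest.step_mem (h : IsHighest k q a i) (hb : Step a i b) : b ∈ C k q := by
  refine ⟨fun j => ?_, fun j => ⟨?_, ?_⟩⟩
  · have h1 := hb j
    have h2 := hb (j + 1)
    have h3 := hb (j + 2)
    have h4 := h.mem.1 j
    by_cases hj : j = i + 1
    · subst hj
      have h5 := h.lt (i + 1) (by omega)
      have h6 := h.lt (i + 2) (by omega)
      have h7 := h.mem.1 (i - 1)
      have h8 := h.tight
      simp only [S, L, add_sub_cancel_right, sub_add_cancel, show i + 1 + 1 = i + 2 by ring,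
        show i - 1 + 2 = i + 1 by ring, show i + 1 + 2 = i + 3 by ring,
        show i + 2 - 1 = i + 1 by ring, show i + 2 + 1 = i + 3 by ring,
        show i + 2 + 2 = i + 4 by ring] at *
      split_ifs at * <;> omega
    · split_ifs at * <;> omega
  · have h1 := hb.S_eq j
    have h2 := h.mem.2 j
    have h3 := h.lt j
    split_ifs at * <;> omega
  · have h1 := hb.L_eq j
    have h2 := h.mem.2 j
    have h3 := h.lt j
    split_ifs at * <;> omega

theorem exists_isHighest_of_tight (ha : a ∈ C k q) (hq : 0 < q) (h : S a i = q ∨ L a i = k + q) :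
    ∃ j, i ≤ j ∧ IsHighest k q a j := by
  have h0 : a ≠ 0 := by
    rintro rfl
    simp [S, L] at h
    omega
  obtain ⟨p, j, hj⟩ := exists_isHighest ha.1 h0
  have hpq : p = q := by
    have h1 := hj.mem.2 i
    have h2 : p ≤ q := hj.weight_eq ▸ Nat.sInf_le ha
    omega
  subst hpq
  refine ⟨j, ?_, hj⟩
  by_contra hlt
  have := hj.lt i (by omega)
  omega

/-- `S` and `L` at `i` itself do not change, so `i` stays tight: the weight is kept and the highest
position does not go down. -/
theorem IsHighest.exists_rightMove (h : IsHighest k q a i) :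
    ∃ j, i ≤ j ∧ IsHighest k q (rightMove k a) j := by
  refine exists_isHighest_of_tight (h.step_mem h.step) h.pos ?_
  have h1 := h.step.S_eq i
  have h2 := h.step.L_eq i
  have h3 := h.tight
  split_ifs at * <;> omega

theorem IsHighest.exists_iterate (h : IsHighest k q a i) (t : ℕ) :
    ∃ j, IsHighest k q ((rightMove k)^[t] a) j := by
  induction t with
  | zero => exact ⟨i, h⟩
  | succ t ih =>
    obtain ⟨j, hj⟩ := ih
    obtain ⟨j', -, hj'⟩ := hj.exists_rightMove
    exact ⟨j', by rwa [Function.iterate_succ_apply']⟩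

end

/-! ### Passage of a particle from the far right: existence and uniqueness. -/

section

variable {k p q : ℕ} {a b c d : Configuration} {u : ℤ → ℤ} {i : ℤ}

theorem int_downward_induction {P : ℤ → Prop} (top : ∃ B, ∀ x, B ≤ x → P x)
    (step : ∀ x, P (x + 1) → P (x + 2) → P x) (x : ℤ) : P x := by
  obtain ⟨B, hB⟩ := top
  have key : ∀ n : ℕ, P (B - n) ∧ P (B - n + 1) := by
    intro n
    induction n with
    | zero => exact ⟨hB _ (by simp), hB _ (by simp)⟩
    | succ n ih =>
      have e1 : B - ((n + 1 : ℕ) : ℤ) + 1 = B - n := by push_cast; ring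
      have e2 : B - ((n + 1 : ℕ) : ℤ) + 2 = B - n + 1 := by push_cast; ring
      refine ⟨step _ ?_ ?_, ?_⟩
      · rw [e1]; exact ih.1
      · rw [e2]; exact ih.2
      · rw [e1]; exact ih.1
  rcases le_total B x with h | h
  · exact hB x h
  · have := (key (B - x).toNat).1
    rwa [Int.toNat_of_nonneg (by omega), sub_sub_cancel] at this

/-- A particle of weight `q` that comes from the far right passes through `c`;
`u x` is the number of units that it carries from the column `x + 1` to the column `x`. -/
structure Carrier (k q : ℕ) (c : Configuration) (u : ℤ → ℤ) : Prop where
  nonneg : ∀ x, 0 ≤ u x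
  top : ∃ B, ∀ x, B ≤ x → u x = q
  le_S : ∀ x, u (x + 1) + S c x ≤ q
  le_L : ∀ x, u (x + 1) + u (x + 2) + L c x ≤ k + q
  tight : ∀ x, u (x + 1) + S c x = q ∨ u (x + 1) + L c (x - 1) = k + q ∨
    u (x + 1) + u (x + 2) + L c x = k + q

/-- A particle of weight `q` that comes from the far right and passes through `c` leaves `d`. -/
structure Pass (k q : ℕ) (c d : Configuration) (u : ℤ → ℤ) : Prop extends Carrier k q c u where
  out : ∀ x, (d x : ℤ) = c x + u x - u (x - 1)

/-- The conditions on a passage at the column `i + n`, in terms of `S`. -/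
theorem Carrier.at (h : Carrier k q c u) (i n : ℤ) :
    0 ≤ u (i + n) ∧ u (i + n) + S c (i + (n - 1)) ≤ q ∧
    u (i + n) + S c (i + (n - 3)) + S c (i + (n - 2)) + S c (i + (n - 1)) ≤ k + q ∧
    u (i + n) + u (i + (n + 1)) + S c (i + (n - 2)) + S c (i + (n - 1)) + S c (i + n) ≤ k + q ∧
    (u (i + n) + S c (i + (n - 1)) = q ∨
      u (i + n) + S c (i + (n - 3)) + S c (i + (n - 2)) + S c (i + (n - 1)) = k + q ∨
      u (i + n) + u (i + (n + 1)) + S c (i + (n - 2)) + S c (i + (n - 1)) + S c (i + n)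
        = k + q) := by
  have h0 := h.nonneg (i + n)
  have h1 := h.nonneg (i + (n - 1))
  have h2 := h.le_S (i + (n - 1))
  have h3 := h.le_L (i + (n - 1))
  have h4 := h.le_L (i + (n - 2))
  have h5 := h.tight (i + (n - 1))
  simp only [L_eq, Nat.cast_add, show i + (n - 1) + 1 = i + n by ring,
    show i + (n - 1) + 2 = i + (n + 1) by ring, show i + (n - 1) - 1 = i + (n - 2) by ring,
    show i + (n - 2) + 1 = i + (n - 1) by ring, show i + (n - 2) - 1 = i + (n - 3) by ring,
    show i + (n - 2) + 2 = i + n by ring] at h3 h4 h5 h2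
  omega

theorem Carrier.le (h : Carrier k q c u) (x : ℤ) : u x ≤ q := by
  have := h.le_S (x - 1)
  simp only [sub_add_cancel] at this
  omega

/-- The inequalities and the tightness say that `u x` is the largest amount allowed by `c` and `u (x
+ 1)`, so `u` is determined recursively from the right. -/
theorem Pass.unique {d' : Configuration} {u' : ℤ → ℤ} (h : Pass k q c d u)
    (h' : Pass k q c d' u') : d = d' := by
  have key : ∀ x, u x = u' x := by
    refine int_downward_induction ?_ fun x h1 _ => ?_
    · obtain ⟨B, hB⟩ := h.top
      obtain ⟨B', hB'⟩ := h'.top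
      refine ⟨max B B', fun x hx => ?_⟩
      rw [hB x (by omega), hB' x (by omega)]
    · have e := h.at x 0
      have e' := h'.at x 0
      simp only [add_zero, zero_add] at e e'
      omega
  ext x
  have h1 := h.out x
  have h2 := h'.out x
  rw [key, key] at h1
  omega

/-- The passing particle keeps the configuration admissible. -/
theorem Carrier.add_le (h : Carrier k q c u) (hc : c ∈ Adm k) (hq : q ≤ k) (x : ℤ) :
    u x + c (x - 2) + c (x - 1) + c x ≤ k := by
  revert x
  refine int_downward_induction ?_ fun x h1 h2 => ?_
  · obtain ⟨B, hB⟩ := eventually_zero c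
    refine ⟨B + 2, fun x hx => ?_⟩
    have := h.le x
    rw [hB x (by omega), hB (x - 1) (by omega), hB (x - 2) (by omega)]
    push_cast
    omega
  · have e0 := h.at x 0
    have e1 := h.at x 1
    have := hc (x - 2)
    simp only [add_zero, zero_add, Int.reduceAdd, Int.reduceSub, S] at e0 e1
    simp only [show x + 1 - 2 = x - 1 by ring, show x + 1 - 1 = x by ring,
      show x + 2 - 1 = x + 1 by ring, add_sub_cancel_right, show x - 2 + 1 = x - 1 by ring,
      show x + -1 = x - 1 by ring, show x + -2 = x - 2 by ring, show x + -3 = x - 3 by ring,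
      sub_add_cancel, show x - 3 + 1 = x - 2 by ring, show x + 1 + 1 = x + 2 by ring]
      at h1 h2 this e0 e1
    omega

theorem S_eq_zero (h0 : a i = 0) (h1 : a (i + 1) = 0) : S a i = 0 := by
  simp only [S]
  omega

theorem L_eq_zero (h0 : a (i - 1) = 0) (h1 : a i = 0) (h2 : a (i + 1) = 0) (h3 : a (i + 2) = 0) :
    L a i = 0 := by
  simp only [L]
  omega

theorem min_min_spec {m a b c : ℤ} (h : m = min (min a b) c) :
    m ≤ a ∧ m ≤ b ∧ m ≤ c ∧ (m = a ∨ m = b ∨ m = c) := by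
  rcases min_cases (min a b) c with h1 | h1 <;> rcases min_cases a b with h2 | h2 <;> omega

theorem exists_pass_aux (k q : ℕ) (hq : q ≤ k) (c : Configuration) :
    ∃ u : ℤ → ℤ, (∃ B, ∀ x, B ≤ x → u x = q) ∧
      ∀ x, u (x + 1) = min (min (q - S c x : ℤ) (k + q - L c (x - 1)))
        (k + q - L c x - u (x + 2)) := by
  obtain ⟨B, hB⟩ := eventually_zero c
  -- `w n` is the value of `u` at the column `B + 4 - n`. The margin 4 ensures that every column
  -- entering the formula is empty when `x + 1 ≥ B + 4`, so that the recursion holds there with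
  -- constant value `q`.
  let w : ℕ → ℤ := fun n => Nat.rec (q : ℤ) (fun n wn =>
    min (min (q - S c (B + 4 - (n + 1) - 1) : ℤ) (k + q - L c (B + 4 - (n + 1) - 1 - 1)))
      (k + q - L c (B + 4 - (n + 1) - 1) - wn)) n
  have hw : ∀ n : ℕ, w (n + 1) =
    min (min (q - S c (B + 4 - (n + 1) - 1) : ℤ) (k + q - L c (B + 4 - (n + 1) - 1 - 1)))
      (k + q - L c (B + 4 - (n + 1) - 1) - w n) := fun n => rfl
  have htop : ∀ x, B + 4 ≤ x → w (B + 4 - x).toNat = q := by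
    intro x hx
    rw [Int.toNat_of_nonpos (by omega)]
    rfl
  refine ⟨fun x => w (B + 4 - x).toNat, ⟨B + 4, htop⟩, fun x => ?_⟩
  rcases le_or_gt (B + 4) (x + 1) with hx | hx
  · simp only []
    rw [htop (x + 1) hx, htop (x + 2) (by omega), S_eq_zero (hB _ (by omega)) (hB _ (by omega)),
      L_eq_zero (hB _ (by omega)) (hB _ (by omega)) (hB _ (by omega)) (hB _ (by omega)),
      L_eq_zero (hB _ (by omega)) (hB _ (by omega)) (hB _ (by omega)) (hB _ (by omega))]
    rw [min_eq_left, min_eq_left] <;> push_cast <;> omega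
  · obtain ⟨n, hn⟩ : ∃ n : ℕ, (n : ℤ) = B + 4 - x - 2 := ⟨(B + 4 - x - 2).toNat, by omega⟩
    have e1 : (B + 4 - (x + 1)).toNat = n + 1 := by omega
    have e2 : (B + 4 - (x + 2)).toNat = n := by omega
    have e3 : B + 4 - ((n : ℤ) + 1) - 1 = x := by omega
    simp only [e1, e2, hw, e3]

theorem exists_pass (hc : c ∈ C k q) (hq : q ≤ k) : ∃ d u, Pass k q c d u := by
  obtain ⟨u, htop, hu⟩ := exists_pass_aux k q hq c
  have hu' := fun x => min_min_spec (hu x)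
  -- The second entry of the minimum is there for this bound, which keeps the third entry
  -- nonnegative one column further left.
  have hle : ∀ x, u (x + 2) ≤ k + q - L c x := by
    intro x
    have := hu' (x + 1)
    simp only [add_sub_cancel_right, show x + 1 + 1 = x + 2 by ring] at this
    omega
  have hnonneg : ∀ x, 0 ≤ u x := by
    intro x
    have h1 := hu' (x - 1)
    have h2 := hle (x - 1)
    have h3 := (hc.2 (x - 1)).1
    have h4 := (hc.2 (x - 1 - 1)).2
    rw [sub_add_cancel] at h1
    omega
  obtain ⟨B, hB⟩ := htop
  have h : Carrier k q c u := by
    refine ⟨hnonneg, ⟨B, hB⟩, fun x => ?_, fun x => ?_, fun x => ?_⟩ <;>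
    · have := hu' x
      omega
  have hout : ∀ x, 0 ≤ c x + u x - u (x - 1) := by
    intro x
    have hadd : u (x + 1) + c (x - 1) + c x + c (x + 1) ≤ k := by
      have := h.add_le hc.1 hq (x + 1)
      rwa [add_sub_cancel_right, show x + 1 - 2 = x - 1 by ring] at this
    have e0 := h.at x 0
    have e1 := h.at x (-1)
    simp only [add_zero, zero_add, Int.reduceAdd, Int.reduceSub, Int.reduceNeg, S,
      show x + -1 = x - 1 by ring, show x + -2 = x - 2 by ring, show x + -3 = x - 3 by ring,
      show x + -4 = x - 4 by ring, show x - 4 + 1 = x - 3 by ring, show x - 2 + 1 = x - 1 by ring,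
      sub_add_cancel, show x - 3 + 1 = x - 2 by ring] at e0 e1
    omega
  obtain ⟨B', hB'⟩ := eventually_zero c
  obtain ⟨A', hA'⟩ := eventually_zero_left c
  have hbot : ∀ x, x ≤ A' - 2 → u x = q := by
    intro x hx
    have e := hu' (x - 1)
    have e1 := h.le (x + 1)
    rw [sub_add_cancel, show x - 1 + 2 = x + 1 by ring,
      S_eq_zero (hA' _ (by omega)) (hA' _ (by omega)),
      L_eq_zero (hA' _ (by omega)) (hA' _ (by omega)) (hA' _ (by omega)) (hA' _ (by omega)),
      L_eq_zero (hA' _ (by omega)) (hA' _ (by omega)) (hA' _ (by omega)) (hA' _ (by omega))] at e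
    push_cast at e
    omega
  refine ⟨Finsupp.ofSupportFinite (fun x => (c x + u x - u (x - 1)).toNat)
    ((Set.finite_Icc (A' - 2) (max B' B + 1)).subset fun x hx => ?_), u, h, fun x => ?_⟩
  · simp only [Function.mem_support] at hx
    rw [Set.mem_Icc]
    by_contra hne
    rw [not_and_or] at hne
    rcases hne with hne | hne
    · rw [hbot x (by omega), hbot (x - 1) (by omega), hA' x (by omega)] at hx
      simp at hx
    · rw [hB x (by omega), hB (x - 1) (by omega), hB' x (by omega)] at hx
      simp at hx
  · simp only [Finsupp.ofSupportFinite_coe]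
    exact Int.toNat_of_nonneg (hout x)

theorem Pass.S_eq (h : Pass k q c d u) (x : ℤ) : (S d x : ℤ) = S c x + u (x + 1) - u (x - 1) := by
  have h1 := h.out x
  have h2 := h.out (x + 1)
  simp only [S, add_sub_cancel_right] at *
  omega

theorem Pass.L_eq (h : Pass k q c d u) (x : ℤ) :
    (L d x : ℤ) = L c x + u (x + 1) + u (x + 2) - u (x - 1) - u (x - 2) := by
  have h1 := h.S_eq x
  have h2 := h.S_eq (x + 1)
  have h3 := h.S_eq (x - 1)
  simp only [Conf.L_eq, add_sub_cancel_right, sub_add_cancel, show x + 1 + 1 = x + 2 by ring,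
    show x - 1 - 1 = x - 2 by ring] at *
  omega

theorem Pass.mem (h : Pass k q c d u) (hc : c ∈ C k q) (hq : q ≤ k) : d ∈ C k q := by
  refine ⟨fun x => ?_, fun x => ⟨?_, ?_⟩⟩
  · have e0 := h.out x
    have e1 := h.out (x + 1)
    have e2 := h.out (x + 2)
    have f1 := h.at x (-1)
    have f2 := h.at x 0
    have f3 := h.at x 1
    have f4 := h.add_le hc.1 hq (x + 2)
    have f5 := h.add_le hc.1 hq (x + 1)
    have f6 := h.add_le hc.1 hq x
    simp only [add_zero, zero_add, Int.reduceAdd, Int.reduceSub, Int.reduceNeg, S] at f1 f2 f3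
    simp only [show x + 1 - 2 = x - 1 by ring, show x + 1 - 1 = x by ring,
      show x + 2 - 1 = x + 1 by ring, add_sub_cancel_right, show x - 2 + 1 = x - 1 by ring,
      show x + -1 = x - 1 by ring, show x + -2 = x - 2 by ring, show x + -3 = x - 3 by ring,
      show x + -4 = x - 4 by ring, show x - 4 + 1 = x - 3 by ring,
      sub_add_cancel, show x - 3 + 1 = x - 2 by ring, show x + 1 + 1 = x + 2 by ring]
      at *
    omega
  · have h1 := h.S_eq x
    have h2 := h.le_S x
    have h3 := h.nonneg (x - 1)
    omega
  · have h1 := h.L_eq x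
    have h2 := h.le_L x
    have h3 := h.nonneg (x - 1)
    have h4 := h.nonneg (x - 2)
    omega

end

/-! ### Effect of a right move of `c` on the carrier. -/

section

variable {k p q : ℕ} {a b c d : Configuration} {u : ℤ → ℤ} {i : ℤ}

theorem L_add (a : Configuration) (i n : ℤ) :
    L a (i + n) = S a (i + (n - 1)) + S a (i + n) + S a (i + (n + 1)) := by
  rw [L_eq, add_sub_assoc, add_assoc i n 1]

theorem IsHighest.lt_add (h : IsHighest k q a i) (n : ℤ) (hn : 0 < n) :
    S a (i + n) < q ∧ S a (i + (n - 1)) + S a (i + n) + S a (i + (n + 1)) < k + q := by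
  have := h.lt (i + n) (by omega)
  rwa [L_add] at this

/-- How the highest position `i` of `c` and the passing particle determine the highest position
of the outcome. -/
inductive Shifted (k p q : ℕ) (c : Configuration) (u : ℤ → ℤ) (i : ℤ) : ℤ → Prop
  | two (h0 : u (i + 1) + S c i = q)
      (h1 : u (i + 2) + S c (i + 1) = q ∨ u (i + 2) + u (i + 3) + L c (i + 1) = k + q)
      (h2 : u (i + 3) + S c (i + 2) = q)
      (h3 : u (i + 3) + u (i + 4) + L c (i + 2) < k + q)
      (h4 : u (i + 3) + L c (i + 1) < k + q) : Shifted k p q c u i (i + 2)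
  | three (h0 : u (i + 1) + S c i = q ∨ u (i + 1) + u (i + 2) + L c i = k + q)
      (h1 : u (i + 2) + S c (i + 1) < q)
      (h2 : u (i + 4) + L c (i + 2) < k + q)
      (h3 : u (i + 3) + u (i + 4) + L c (i + 2) = k + q ∨ u (i + 3) + L c (i + 1) = k + q) :
      Shifted k p q c u i (i + 3)
  | four (h0 : u (i + 1) + S c i = q ∨ u (i + 1) + u (i + 2) + L c i = k + q)
      (h1 : u (i + 4) + L c (i + 2) = k + q)
      (h2 : L c i = k + p)
      (h3 : u (i + 2) = q - p) : Shifted k p q c u i (i + 4)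

-- Tightness of `c` at `i` restricts which constraints bind the carrier at `i + 1`. The three cases
-- are then told apart by the constraints that bind at `i + 3` and `i + 4`; when none of those
-- involving `L` does, the one in `S` must bind at `i + 3`.
set_option maxHeartbeats 1000000 in
theorem Carrier.exists_shifted (h : Carrier k q c u) (hc : IsHighest k p c i) (hpq : p ≤ q)
    (hq : q ≤ k) : ∃ j, Shifted k p q c u i j := by
  have e1 := h.at i 1
  have e2 := h.at i 2
  have e3 := h.at i 3
  have e4 := h.at i 4
  have e5 := h.nonneg i
  have e6 := h.nonneg (i + 5)
  have f1 := hc.lt_add 1 (by omega)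
  have f2 := hc.lt_add 2 (by omega)
  have f3 := hc.lt_add 3 (by omega)
  have g0 := hc.mem.2 i
  have g1 := (hc.mem.2 (i + -1))
  have g2 := h.add_le hc.mem.1 hq (i + 4)
  have t := hc.tight
  have l0 := L_add c i 0
  have l1 := L_add c i 1
  have l2 := L_add c i 2
  have l3 := L_add c i (-1)
  simp only [add_zero, zero_add, Int.reduceAdd, Int.reduceSub, Int.reduceNeg] at *
  have s1 : S c (i + 1) = c (i + 1) + c (i + 2) := by rw [S, add_assoc]; rfl
  have s2 : S c (i + 2) = c (i + 2) + c (i + 3) := by rw [S, add_assoc]; rfl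
  have s3 : S c (i + 3) = c (i + 3) + c (i + 4) := by rw [S, add_assoc]; rfl
  rw [show i + 4 - 2 = i + 2 by ring, show i + 4 - 1 = i + 3 by ring] at g2
  have h0 : u (i + 1) + S c i = q ∨ u (i + 1) + u (i + 2) + L c i = k + q := by omega
  by_cases c4 : u (i + 4) + L c (i + 2) = k + q
  · refine ⟨_, .four h0 c4 ?_ ?_⟩
    · clear e1 e3
      omega
    · have : L c i = k + p := by
        clear e1 e3
        omega
      clear e1
      omega
  by_cases c3 : u (i + 3) + u (i + 4) + L c (i + 2) = k + q ∨ u (i + 3) + L c (i + 1) = k + q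
  · refine ⟨_, .three h0 ?_ ?_ c3⟩
    · by_contra hne
      have : u (i + 2) + S c (i + 1) = q := by omega
      clear e1
      omega
    · omega
  · have h2 : u (i + 3) + S c (i + 2) = q := by omega
    have h1 : u (i + 2) + S c (i + 1) = q ∨ u (i + 2) + u (i + 3) + L c (i + 1) = k + q := by
      clear e1 e3 e4
      omega
    refine ⟨_, .two ?_ h1 h2 ?_ ?_⟩
    · omega
    · push Not at c3
      exact lt_of_le_of_ne (by linarith only [e3.2.2.2.1, l2]) c3.1
    · push Not at c3
      exact lt_of_le_of_ne (by linarith only [e3.2.2.1, l1]) c3.2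

theorem Shifted.bounds {j : ℤ} (hj : Shifted k p q c u i j) : i + 2 ≤ j ∧ j ≤ i + 4 := by
  cases hj <;> omega

theorem Shifted.pos (hc : IsHighest k p c i) (hpq : p ≤ q) {j : ℤ}
    (hj : Shifted k p q c u i j) : 1 ≤ u j := by
  have f1 := hc.lt (i + 1) (by omega)
  cases hj <;> [skip; skip; have f2 := hc.lt (i + 2) (by omega)] <;> omega

theorem Carrier.shift_le_S (h : Carrier k q c u) (hc : IsHighest k p c i) {j : ℤ}
    (hj : Shifted k p q c u i j) {c' : Configuration} (hc' : Step c i c') (x : ℤ) :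
    u (x + 1) + (if x + 1 = i then 1 else 0) - (if x + 1 = j then 1 else 0) + S c' x ≤ q := by
  have h1 := h.le_S x
  have h2 := hc'.S_eq x
  have h3 := hj.bounds
  by_cases hx : x = i + 1
  · subst hx
    have f1 := (hc.lt (i + 1) (by omega)).2
    have e3 := h.le_L (i + 1)
    have f2 := (hc.lt (i + 1) (by omega)).1
    simp only [add_assoc, Int.reduceAdd] at *
    cases hj <;> split_ifs at * <;> omega
  · split_ifs at * <;> omega

theorem Carrier.shift_le_L (h : Carrier k q c u) (hc : IsHighest k p c i) {j : ℤ}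
    (hj : Shifted k p q c u i j) {c' : Configuration} (hc' : Step c i c') (x : ℤ) :
    u (x + 1) + (if x + 1 = i then 1 else 0) - (if x + 1 = j then 1 else 0) +
      (u (x + 2) + (if x + 2 = i then 1 else 0) - (if x + 2 = j then 1 else 0)) + L c' x
      ≤ k + q := by
  have h1 := h.le_L x
  have h2 := hc'.L_eq x
  have h3 := hj.bounds
  by_cases hx : x = i + 1
  · subst hx
    have f1 := (hc.lt (i + 1) (by omega)).2
    have n4 := h.nonneg (i + 4)
    have e2 := h.le_L (i + 2)
    simp only [add_assoc, Int.reduceAdd] at *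
    cases hj <;> split_ifs at * <;> omega
  by_cases hx : x = i + 2
  · subst hx
    simp only [add_assoc, Int.reduceAdd] at *
    cases hj <;> split_ifs at * <;> omega
  · split_ifs at * <;> omega

set_option maxHeartbeats 1000000 in
theorem Carrier.shift_tight (h : Carrier k q c u) {j : ℤ}
    (hj : Shifted k p q c u i j) {c' : Configuration} (hc' : Step c i c') (x : ℤ) :
    u (x + 1) + (if x + 1 = i then 1 else 0) - (if x + 1 = j then 1 else 0) + S c' x = q ∨
    u (x + 1) + (if x + 1 = i then 1 else 0) - (if x + 1 = j then 1 else 0) + L c' (x - 1) = k + q ∨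
    u (x + 1) + (if x + 1 = i then 1 else 0) - (if x + 1 = j then 1 else 0) +
      (u (x + 2) + (if x + 2 = i then 1 else 0) - (if x + 2 = j then 1 else 0)) + L c' x
      = k + q := by
  have h1 := h.tight x
  have h2 := hc'.S_eq x
  have h3 := hc'.L_eq x
  have h4 := hc'.L_eq (x - 1)
  have hb := hj.bounds
  have n3 := h.nonneg (i + 3)
  have l2 := h.le_L (i + 2)
  simp only [add_assoc, Int.reduceAdd] at l2
  by_cases hx : x = i
  · subst hx
    cases hj <;> simp [sub_eq_add_neg] at h2 h3 h4 ⊢ <;> omega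
  by_cases hx : x = i + 1
  · subst hx
    simp only [add_assoc, Int.reduceAdd, add_sub_cancel_right] at *
    cases hj <;> simp [sub_eq_add_neg] at h2 h3 h4 ⊢ <;> omega
  by_cases hx : x = i + 2
  · subst hx
    simp only [add_assoc, Int.reduceAdd, show i + 2 - 1 = i + 1 by ring] at *
    cases hj <;> simp [sub_eq_add_neg] at h2 h3 h4 ⊢ <;> omega
  by_cases hx : x = i + 3
  · subst hx
    simp only [add_assoc, Int.reduceAdd, show i + 3 - 1 = i + 2 by ring] at *
    cases hj <;> simp [sub_eq_add_neg] at h2 h3 h4 ⊢ <;> omega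
  clear hj
  split_ifs at * <;> omega

/-- One more unit carried from `i + 1` to `i` undoes the move of `c`, and one unit fewer carried
from `j + 1` to `j` produces the move of `d`. The content is that this modified carrier is still the
maximal one. -/
theorem Pass.shift (h : Pass k q c d u) (hc : IsHighest k p c i) (hpq : p ≤ q) {j : ℤ}
    (hj : Shifted k p q c u i j) {c' d' : Configuration} (hc' : Step c i c') (hd' : Step d j d') :
    Pass k q c' d' fun x => u x + (if x = i then 1 else 0) - (if x = j then 1 else 0) := by
  refine ⟨⟨fun x => ?_, ?_, h.shift_le_S hc hj hc', h.shift_le_L hc hj hc',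
    h.shift_tight hj hc'⟩, fun x => ?_⟩
  · have h1 := h.nonneg x
    have h2 := hj.pos hc hpq
    by_cases hx : x = j
    · subst hx
      split_ifs <;> omega
    · split_ifs <;> omega
  · obtain ⟨B, hB⟩ := h.top
    refine ⟨max (max B (i + 1)) (j + 1), fun x hx => ?_⟩
    rw [hB x (by omega), if_neg (by omega), if_neg (by omega)]
    ring
  · have h1 := h.out x
    simp only [hc' x, hd' x, sub_eq_iff_eq_add]
    split_ifs <;> omega

end

/-! ### Weight and highest position of the outcome; the passage commutes with right moves. -/

section

variable {k p q : ℕ} {a b c d : Configuration} {u : ℤ → ℤ} {i : ℤ}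

theorem C.S_le (hc : c ∈ C k p) (i n : ℤ) : S c (i + n) ≤ p := (hc.2 _).1

theorem C.L_le (hc : c ∈ C k p) (i n : ℤ) :
    S c (i + (n - 1)) + S c (i + n) + S c (i + (n + 1)) ≤ k + p := by
  rw [← L_add]
  exact (hc.2 _).2

theorem Pass.S_eq_add (h : Pass k q c d u) (i n : ℤ) :
    (S d (i + n) : ℤ) = S c (i + n) + u (i + (n + 1)) - u (i + (n - 1)) := by
  rw [h.S_eq, add_assoc i n 1, add_sub_assoc i n 1]

/-- According to which constraint on `u (x - 1)` is tight, `S d x` is at most `S c (x - 2)`, `L c (x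
- 3) - k` or `S c (x - 3)`, and each of these is at most `p`. -/
theorem Pass.weight_S_le (h : Pass k q c d u) (hc : c ∈ C k p) (x : ℤ) :
    S d x ≤ p := by
  have e0 := h.at x (-1)
  have e1 := h.at x 0
  have e2 := h.at x 1
  have f := h.S_eq_add x 0
  have g1 := C.S_le hc x (-3)
  have g2 := C.S_le hc x (-2)
  have g3 := C.L_le hc x (-3)
  have g4 := C.L_le hc x (-2)
  simp only [add_zero, zero_add, Int.reduceAdd, Int.reduceSub, Int.reduceNeg] at *
  omega

theorem Pass.weight_L_le (h : Pass k q c d u) (hc : c ∈ C k p) (x : ℤ) :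
    L d x ≤ k + p := by
  have e0 := h.at x (-2)
  have e1 := h.at x (-1)
  have e2 := h.le_L x
  have f := h.L_eq x
  have g1 := C.S_le hc x (-2)
  have g2 := C.S_le hc x (-3)
  have g3 := C.L_le hc x (-3)
  have g4 := C.L_le hc x (-4)
  simp only [add_zero, Int.reduceAdd, Int.reduceSub, Int.reduceNeg,
    ← sub_eq_add_neg] at *
  omega

theorem Pass.weight_mem (h : Pass k q c d u) (hc : c ∈ C k p) (hpq : p ≤ q) (hq : q ≤ k) :
    d ∈ C k p :=
  ⟨(h.mem (C_mono hpq hc) hq).1, fun x => ⟨h.weight_S_le hc x, h.weight_L_le hc x⟩⟩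

/-- For `x ≥ i + 4` the bounds of `Pass.weight_S_le` only involve columns to the right of `i`, where
they are strict. Only `x = i + 3` reaches back to `i` and needs the case distinction. -/
theorem Pass.S_lt_of_shifted (h : Pass k q c d u) (hc : IsHighest k p c i) {j : ℤ}
    (hj : Shifted k p q c u i j) (x : ℤ) (hx : j < x) : S d x < p := by
  have hb := hj.bounds
  have f := h.S_eq_add x 0
  have e0 := h.at x (-1)
  have e1 := h.at x 0
  have e2 := h.le_S x
  have g2 := hc.lt_add (x - i - 2) (by omega)
  simp only [show i + (x - i - 2) = x - 2 by ring, show i + (x - i - 2 - 1) = x - 3 by ring,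
    show i + (x - i - 2 + 1) = x - 1 by ring] at g2
  simp only [add_zero, zero_add, Int.reduceAdd, Int.reduceSub, Int.reduceNeg,
    ← sub_eq_add_neg] at *
  by_cases hx3 : x = i + 3
  · have g1 := (hc.lt (i + 1) (by omega)).1
    have g3 := hc.mem.2 i
    have l1 := L_add c i 1
    have l2 := L_add c i 2
    have n1 := h.nonneg (i + 1)
    have s1 := h.at i 2
    subst hx3
    simp only [add_assoc, Int.reduceAdd, Int.reduceSub, show i + 3 - 1 = i + 2 by ring,
      show i + 3 - 2 = i + 1 by ring, show i + 3 - 3 = i by ring, add_zero] at *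
    cases hj <;> omega
  · have g3 := hc.lt_add (x - i - 3) (by omega)
    simp only [show i + (x - i - 3) = x - 3 by ring, show i + (x - i - 3 - 1) = x - 4 by ring,
      show i + (x - i - 3 + 1) = x - 2 by ring] at g3
    omega

theorem Pass.L_lt_of_shifted (h : Pass k q c d u) (hc : IsHighest k p c i) {j : ℤ}
    (hj : Shifted k p q c u i j) (x : ℤ) (hx : j < x) : L d x < k + p := by
  have hb := hj.bounds
  have f := h.L_eq x
  have e2 := h.le_L x
  by_cases hx3 : x = i + 3
  · have s1 := h.at i 1
    have s2 := h.at i 2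
    have s3 := h.at i 3
    have g0 := hc.mem.2 i
    have g1 := hc.lt (i + 1) (by omega)
    have l1 := L_add c i 1
    have l2 := L_add c i 2
    subst hx3
    simp only [add_assoc, Int.reduceAdd, Int.reduceSub, show i + 3 - 1 = i + 2 by ring,
      show i + 3 - 2 = i + 1 by ring, add_zero] at *
    cases hj <;> omega
  by_cases hx4 : x = i + 4
  · have s1 := h.at i 1
    have s2 := h.at i 2
    have s3 := h.at i 3
    have g0 := hc.mem.2 i
    have g1 := hc.lt_add 1 (by omega)
    have g2 := hc.lt_add 2 (by omega)
    have l1 := L_add c i 1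
    have l2 := L_add c i 2
    subst hx4
    simp only [add_assoc, Int.reduceAdd, Int.reduceSub, show i + 4 - 1 = i + 3 by ring,
      show i + 4 - 2 = i + 2 by ring, add_zero] at *
    cases hj <;> omega
  · have e0 := h.at x (-1)
    have e1 := h.at x (-2)
    have g2 := hc.lt_add (x - i - 2) (by omega)
    have g3 := hc.lt_add (x - i - 3) (by omega)
    have g4 := hc.lt_add (x - i - 4) (by omega)
    simp only [show i + (x - i - 4) = x - 4 by ring, show i + (x - i - 4 - 1) = x - 5 by ring,
      show i + (x - i - 4 + 1) = x - 3 by ring,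
      show i + (x - i - 2) = x - 2 by ring, show i + (x - i - 2 - 1) = x - 3 by ring,
      show i + (x - i - 2 + 1) = x - 1 by ring, show i + (x - i - 3) = x - 3 by ring,
      show i + (x - i - 3 - 1) = x - 4 by ring, show i + (x - i - 3 + 1) = x - 2 by ring,
      add_zero, Int.reduceAdd, Int.reduceSub, Int.reduceNeg, ← sub_eq_add_neg] at *
    omega

theorem Pass.tight_of_two (h : Pass k q c d u) (hc : IsHighest k p c i)
    (h0 : u (i + 1) + S c i = q) (h2 : u (i + 3) + S c (i + 2) = q)
    (h4 : u (i + 3) + L c (i + 1) < k + q)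
    (h1 : u (i + 2) + S c (i + 1) = q ∨ u (i + 2) + u (i + 3) + L c (i + 1) = k + q) :
    S d (i + 2) = p := by
  have f1 := h.S_eq (i + 2)
  have t := hc.tight
  have g0 := hc.mem.2 i
  have g1 := (hc.lt (i + 1) (by omega)).1
  have l0 := h.le_L i
  have n2 := h.nonneg (i + 2)
  simp only [add_assoc, Int.reduceAdd, show i + 2 - 1 = i + 1 by ring] at *
  omega

theorem Pass.tight_of_three (h : Pass k q c d u) (hc : IsHighest k p c i) (hpq : p ≤ q)
    (h0 : u (i + 1) + S c i = q ∨ u (i + 1) + u (i + 2) + L c i = k + q)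
    (h1 : u (i + 2) + S c (i + 1) < q)
    (h2 : u (i + 4) + L c (i + 2) < k + q)
    (h3 : u (i + 3) + u (i + 4) + L c (i + 2) = k + q ∨ u (i + 3) + L c (i + 1) = k + q) :
    S d (i + 3) = p ∨ L d (i + 3) = k + p := by
  have w1 := h.weight_S_le hc.mem (i + 3)
  have w2 := h.weight_L_le hc.mem (i + 3)
  have f1 := h.S_eq (i + 3)
  have f2 := h.L_eq (i + 3)
  have g0 := hc.mem.2 i
  have g1 := (hc.lt (i + 1) (by omega)).2
  have l0 := L_add c i 0
  have l1 := L_add c i 1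
  have l2 := L_add c i 2
  have n1 := h.nonneg (i + 1)
  have n2 := h.nonneg (i + 2)
  have t2 := h.tight (i + 1)
  have t4 := h.tight (i + 3)
  have e1 := h.le_L i
  have e2 := h.le_L (i + 1)
  have e3 := h.le_L (i + 2)
  have e4 := h.le_L (i + 3)
  have e5 := h.le_S (i + 3)
  have e6 := h.le_S i
  simp only [add_assoc, Int.reduceAdd, Int.reduceSub, show i + 3 - 1 = i + 2 by ring,
    show i + 3 - 2 = i + 1 by ring, add_zero, add_sub_cancel_right, zero_add] at *
  have hu3 : 1 ≤ u (i + 3) := by omega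
  have t4' : u (i + 4) + S c (i + 3) = q ∨ u (i + 4) + u (i + 5) + L c (i + 3) = k + q := by omega
  clear t4
  rcases hc.tight with t | t
  · by_cases c1 : u (i + 2) + u (i + 3) + L c (i + 1) = k + q
    · clear t2
      rcases h3 with h3 | h3
      · left; clear t4' h0; omega
      · rcases t4' with t4' | t4'
        · left; omega
        · right; omega
    · have t2' : u (i + 2) + L c i = k + q := by omega
      clear t2
      exfalso
      omega
  · clear t2 h3 e2
    rcases t4' with t4' | t4'
    · left; omega
    · right; omega

theorem Pass.tight_of_four (h : Pass k q c d u) (hc : IsHighest k p c i)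
    (h1 : u (i + 4) + L c (i + 2) = k + q) (h2 : L c i = k + p) (h3 : u (i + 2) = q - p) :
    S d (i + 4) = p ∨ L d (i + 4) = k + p := by
  have w1 := h.weight_S_le hc.mem (i + 4)
  have f1 := h.S_eq (i + 4)
  have f2 := h.L_eq (i + 4)
  have n1 := h.nonneg (i + 1)
  have n2 := h.nonneg (i + 2)
  have n3 := h.nonneg (i + 3)
  have g2 := (hc.lt (i + 2) (by omega)).2
  have s3 := h.le_L (i + 2)
  have s4 := h.le_L (i + 3)
  have s5 := h.tight (i + 4)
  simp only [add_assoc, Int.reduceAdd, show i + 4 - 1 = i + 3 by ring,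
    show i + 4 - 2 = i + 2 by ring] at *
  omega

theorem Pass.tight_of_shifted (h : Pass k q c d u) (hc : IsHighest k p c i) (hpq : p ≤ q) {j : ℤ}
    (hj : Shifted k p q c u i j) : S d j = p ∨ L d j = k + p := by
  cases hj with
  | two h0 h1 h2 h3 h4 => exact .inl (h.tight_of_two hc h0 h2 h4 h1)
  | three h0 h1 h2 h3 => exact h.tight_of_three hc hpq h0 h1 h2 h3
  | four h0 h1 h2 h3 => exact h.tight_of_four hc h1 h2 h3

theorem Pass.isHighest (h : Pass k q c d u) (hc : IsHighest k p c i) (hpq : p ≤ q) (hq : q ≤ k)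
    {j : ℤ} (hj : Shifted k p q c u i j) : IsHighest k p d j :=
  ⟨h.weight_mem hc.mem hpq hq, h.tight_of_shifted hc hpq hj, fun x hx =>
    ⟨h.S_lt_of_shifted hc hj x hx, h.L_lt_of_shifted hc hj x hx⟩⟩

/-- The right move of `c` commutes with the passage of a heavier particle. -/
theorem Pass.exists_rightMove (h : Pass k q c d u) (hc : IsHighest k p c i) (hpq : p ≤ q)
    (hq : q ≤ k) : (∃ j, IsHighest k p d j) ∧ ∃ u', Pass k q (rightMove k c) (rightMove k d) u' := by
  obtain ⟨j, hj⟩ := h.exists_shifted hc hpq hq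
  have hd := h.isHighest hc hpq hq hj
  exact ⟨⟨j, hd⟩, _, h.shift hc hpq hj hc.step hd.step⟩

theorem Pass.exists_iterate (h : Pass k q c d u) (hc : IsHighest k p c i) (hpq : p ≤ q)
    (hq : q ≤ k) (t : ℕ) : ∃ u', Pass k q ((rightMove k)^[t] c) ((rightMove k)^[t] d) u' := by
  induction t with
  | zero => exact ⟨u, h⟩
  | succ t ih =>
    obtain ⟨u', h'⟩ := ih
    obtain ⟨j, hj⟩ := hc.exists_iterate t
    rw [Function.iterate_succ_apply', Function.iterate_succ_apply']
    exact (h'.exists_rightMove hj hpq hq).2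

end

/-! ### Free particles and their removal. -/

section

variable {k p q r : ℕ} {a b c d : Configuration} {u : ℤ → ℤ} {i h e : ℤ}

theorem C_of_le (hb : b ∈ C k q) (hcb : c ≤ b) : c ∈ C k q := by
  refine ⟨fun i => ?_, fun i => ?_⟩
  · have h1 := hb.1 i
    have h2 := hcb i
    have h3 := hcb (i + 1)
    have h4 := hcb (i + 2)
    omega
  · have h1 := hb.2 i
    have h2 := hcb i
    have h3 := hcb (i + 1)
    have h4 := hcb (i + 2)
    have h5 := hcb (i - 1)
    simp only [S, L] at *
    omega

/-- The configuration `c` together with a particle of weight `p` in the columns `h` and `h + 1`,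
which has `r` units in the column `h + 1`. -/
noncomputable def withParticle (c : Configuration) (p : ℕ) (h : ℤ) (r : ℕ) : Configuration :=
  c + Finsupp.single h (p - r) + Finsupp.single (h + 1) r

theorem withParticle_apply (c : Configuration) (p : ℕ) (h : ℤ) (r : ℕ) (y : ℤ) :
    withParticle c p h r y = c y + (if y = h then p - r else 0) + (if y = h + 1 then r else 0) := by
  simp only [withParticle, Finsupp.add_apply, Finsupp.single_apply, eq_comm]

theorem withParticle_self : withParticle c p h p = withParticle c p (h + 1) 0 := by
  simp [withParticle]

/-- A particle to the right of everything else is free: right moves act on it alone, and `p` of them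
advance it by one column. -/
theorem isHighest_withParticle (hc : ∀ y, h - 1 ≤ y → c y = 0) (hp : p ≤ k) (hr : r < p)
    (hm : withParticle c p h r ∈ C k p) : IsHighest k p (withParticle c p h r) h := by
  have hS : ∀ y, h ≤ y → S (withParticle c p h r) y =
      if y = h then p else if y = h + 1 then r else 0 := by
    intro y hy
    simp only [S, withParticle_apply]
    rw [hc y (by omega), hc (y + 1) (by omega)]
    split_ifs <;> omega
  refine ⟨hm, .inl ?_, fun j hj => ⟨?_, ?_⟩⟩
  · rw [hS h le_rfl, if_pos rfl]
  · rw [hS j hj.le]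
    split_ifs <;> omega
  · rw [L_eq, hS j hj.le, hS (j - 1) (by omega), hS (j + 1) (by omega)]
    split_ifs <;> omega

theorem rightMove_withParticle (hc : ∀ y, h - 1 ≤ y → c y = 0) (hp : p ≤ k) (hr : r < p)
    (hm : withParticle c p h r ∈ C k p) :
    rightMove k (withParticle c p h r) = withParticle c p h (r + 1) ∧
      withParticle c p h (r + 1) ∈ C k p := by
  have hh := isHighest_withParticle hc hp hr hm
  have he : rightMove k (withParticle c p h r) = withParticle c p h (r + 1) := by
    refine hh.step.unique fun y => ?_
    simp only [withParticle_apply]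
    split_ifs <;> omega
  exact ⟨he, he ▸ hh.step_mem hh.step⟩

theorem iterate_withParticle (hc : ∀ y, h - 1 ≤ y → c y = 0) (hp : p ≤ k)
    (hm : withParticle c p h r ∈ C k p) (j : ℕ) (hj : r + j ≤ p) :
    (rightMove k)^[j] (withParticle c p h r) = withParticle c p h (r + j) ∧
      withParticle c p h (r + j) ∈ C k p := by
  induction j with
  | zero => exact ⟨rfl, hm⟩
  | succ j ih =>
    obtain ⟨h1, h2⟩ := ih (by omega)
    rw [Function.iterate_succ_apply', h1]
    exact rightMove_withParticle hc hp (by omega) h2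

theorem iterate_mul_withParticle (hc : ∀ y, h - 1 ≤ y → c y = 0) (hp : p ≤ k)
    (hm : withParticle c p h 0 ∈ C k p) (n : ℕ) :
    (rightMove k)^[p * n] (withParticle c p h 0) = withParticle c p (h + n) 0 ∧
      withParticle c p (h + n) 0 ∈ C k p := by
  induction n with
  | zero => simpa using hm
  | succ n ih =>
    have h1 := iterate_withParticle (h := h + n) (fun y hy => hc y (by omega)) hp ih.2 p (by omega)
    rw [Nat.mul_succ, add_comm, Function.iterate_add_apply, ih.1]
    rw [zero_add, withParticle_self] at h1
    push_cast
    rw [← add_assoc]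
    exact h1

theorem endsAt_endpoint (ha : a ≠ 0) : EndsAt a (endpoint a) := by
  obtain ⟨x, hx⟩ : ∃ x, a x ≠ 0 := by
    by_contra hne
    push Not at hne
    exact ha (Finsupp.ext hne)
  obtain ⟨B, hB⟩ := eventually_zero a
  obtain ⟨m, hm, hmax⟩ := Int.exists_greatest_of_bdd (P := fun i => a i ≠ 0)
    ⟨B, fun z hz => by
      by_contra hlt
      exact hz (hB z (by omega))⟩ ⟨x, hx⟩
  have : IsGreatest {i | a i ≠ 0} m := ⟨hm, fun z hz => hmax z hz⟩
  rw [endpoint, this.csSup_eq]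
  refine ⟨by simpa using hm, fun j hj => ?_⟩
  by_contra hne
  have := hmax j hne
  omega

theorem EndsAt.unique {e' : ℤ} (h1 : EndsAt a e) (h2 : EndsAt a e') : e = e' := by
  rcases lt_trichotomy e e' with hlt | heq | hlt
  · exact absurd (h1.2 (e' - 1) (by omega)) h2.1
  · exact heq
  · exact absurd (h2.2 (e - 1) (by omega)) h1.1

theorem IsHighest.lt_of_endsAt (hi : IsHighest k q a i) (he : EndsAt a e) : i < e := by
  by_contra hne
  have := he.2 i (by omega)
  have := hi.apply_pos
  omega

theorem IsHighest.endsAt_rightMove (hi : IsHighest k q a i) (he : EndsAt a e) :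
    EndsAt (rightMove k a) e ↔ i ≠ e - 1 := by
  have hlt := hi.lt_of_endsAt he
  constructor
  · rintro h1 rfl
    have h2 := h1.2 e le_rfl
    have h3 := hi.step e
    simp at h3
    omega
  · intro hne
    refine ⟨?_, fun j hj => ?_⟩
    · have h1 := hi.step (e - 1)
      have h2 := he.1
      split_ifs at h1 <;> omega
    · have h1 := hi.step j
      have h2 := he.2 j hj
      split_ifs at h1 <;> omega

/-- The linear functional on configurations with the weight `f i` in the column `i`. -/
noncomputable def total (f : ℤ → ℤ) (a : Configuration) : ℤ := a.sum fun i n => f i * n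

theorem total_add (f : ℤ → ℤ) (a b : Configuration) : total f (a + b) = total f a + total f b :=
  Finsupp.sum_add_index' (by simp) (by intros; push_cast; ring)

theorem total_single (f : ℤ → ℤ) (i : ℤ) (n : ℕ) : total f (Finsupp.single i n) = f i * n :=
  Finsupp.sum_single_index (by simp)

theorem total_one (a : Configuration) : total (fun _ => 1) a = size a := by
  simp [total, size, Finsupp.sum]

theorem Step.total_eq (hs : Step a i b) (f : ℤ → ℤ) : total f b = total f a + f (i + 1) - f i := by
  have h1 : b + Finsupp.single i 1 = a + Finsupp.single (i + 1) 1 := by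
    ext y
    have := hs y
    simp only [Finsupp.add_apply, Finsupp.single_apply, eq_comm (b := y)]
    split_ifs at * <;> omega
  have h2 := congrArg (total f) h1
  simp only [total_add, total_single] at h2
  push_cast at h2
  linarith

theorem EndsAt.total_le (he : EndsAt a e) : total id a ≤ (e - 1) * size a := by
  rw [← total_one]
  simp only [total, Finsupp.sum, Finset.mul_sum]
  refine Finset.sum_le_sum fun i hi => ?_
  rw [one_mul]
  refine mul_le_mul_of_nonneg_right ?_ (by positivity)
  by_contra hne
  exact Finsupp.mem_support_iff.1 hi (he.2 i (by simp at hne; omega))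

theorem IsHighest.exists_break (hi : IsHighest k q a i) :
    ∃ t, ¬ EndsAt ((rightMove k)^[t + 1] a) (endpoint a) := by
  by_contra hne
  push Not at hne
  have key : ∀ t : ℕ, total id ((rightMove k)^[t] a) = total id a + t ∧
      size ((rightMove k)^[t] a) = size a := by
    intro t
    induction t with
    | zero => simp
    | succ t ih =>
      obtain ⟨j, hj⟩ := hi.exists_iterate t
      have h1 := hj.step.total_eq id
      have h2 := hj.step.total_eq fun _ => 1
      rw [total_one, total_one] at h2
      rw [Function.iterate_succ_apply']
      simp only [id] at h1
      push_cast
      omega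
  -- Each move raises the energy `∑ i a_i` by one, while a fixed end point bounds it by `(endpoint a
  -- - 1) * size a`; this many moves and one more exceed the bound.
  have h1 := (hne ((endpoint a - 1) * size a - total id a).toNat).total_le
  rw [(key _).1, (key _).2] at h1
  push_cast at h1
  omega

/-- When the highest position is the last occupied column, tightness forces `q` units there: `L = k
+ q` splits as `(b_{e-2} + b_{e-1}) + b_{e-1}` with terms at most `k` and `q`. Then `S ≤ q` empties
the column `e - 2`. -/
theorem IsHighest.exists_eq_withParticle (hi : IsHighest k q b (e - 1)) (he : EndsAt b e) :
    b = withParticle (b.filter fun i => i ≤ e - 2) q (e - 1) 0 ∧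
      ∀ y, e - 1 - 1 ≤ y → (b.filter fun i => i ≤ e - 2) y = 0 := by
  have h1 := he.2 e le_rfl
  have h2 := he.2 (e + 1) (by omega)
  have h3 := hi.tight
  have h4 := hi.mem.2 (e - 1)
  have h5 := hi.mem.2 (e - 1 - 1)
  have h6 := hi.mem.1 (e - 1 - 1)
  simp only [S, L, sub_add_cancel, show e - 1 + 2 = e + 1 by ring, show e - 1 - 1 + 2 = e by ring]
    at h3 h4 h5 h6
  have h7 : b (e - 1) = q := by omega
  have h8 : b (e - 2) = 0 := by
    rw [show e - 2 = e - 1 - 1 by ring]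
    omega
  refine ⟨Finsupp.ext fun y => ?_, fun y hy => ?_⟩
  · rw [withParticle_apply, Finsupp.filter_apply]
    by_cases hy : y = e - 1
    · subst hy
      simp [h7]
      omega
    · by_cases hy' : y ≤ e - 2
      · simp [hy, hy']
      · simp [hy, hy', he.2 y (by omega)]
  · rw [Finsupp.filter_apply]
    split_ifs with hle
    · rw [show y = e - 2 by omega, h8]
    · rfl

/-- The end point changes exactly when the unit is taken from the last occupied column, so at the
break time the highest position is `endpoint a - 1` and the particle is free. -/
theorem IsHighest.removal (hi : IsHighest k q a i) :
    (rightMove k)^[breakTime k a] a = withParticle (removeParticle k a) q (endpoint a - 1) 0 ∧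
    (∀ y, endpoint a - 1 - 1 ≤ y → removeParticle k a y = 0) ∧
    shift k a = q * (endpoint a - 1) - breakTime k a ∧
    ∀ t < breakTime k a, EndsAt ((rightMove k)^[t + 1] a) (endpoint a) := by
  have hbreak : ¬ EndsAt ((rightMove k)^[breakTime k a + 1] a) (endpoint a) :=
    Nat.sInf_mem (s := {t | ¬ EndsAt ((rightMove k)^[t + 1] a) (endpoint a)}) hi.exists_break
  have hbefore : ∀ t < breakTime k a, EndsAt ((rightMove k)^[t + 1] a) (endpoint a) := by
    intro t ht
    by_contra hne
    exact Nat.notMem_of_lt_sInf ht hne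
  have hends : EndsAt ((rightMove k)^[breakTime k a] a) (endpoint a) := by
    rcases hb : breakTime k a with _ | t
    · exact endsAt_endpoint hi.ne_zero
    · exact hbefore t (by omega)
  obtain ⟨j, hj⟩ := hi.exists_iterate (breakTime k a)
  rw [Function.iterate_succ_apply', hj.endsAt_rightMove hends, not_not] at hbreak
  subst hbreak
  obtain ⟨h1, h2⟩ := hj.exists_eq_withParticle hends
  refine ⟨h1, h2, ?_, hbefore⟩
  have h3 := congrArg (fun b => b (endpoint a - 1)) h1
  simp only [withParticle_apply] at h3
  rw [h2 _ (by omega)] at h3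
  rw [shift, freeEnergy, freed, hj.highest_eq, sub_add_cancel, hends.2 _ le_rfl, h3]
  simp
  ring

theorem endsAt_withParticle (hc : ∀ y, h - 1 ≤ y → c y = 0) (hp : 0 < p) :
    EndsAt (withParticle c p h 0) (h + 1) := by
  refine ⟨?_, fun j hj => ?_⟩
  · simp [withParticle_apply]
    omega
  · simp [withParticle_apply, hc j (by omega), show j ≠ h by omega]

/-- The removed particle and its energy can be read off after any sufficiently late move. -/
theorem IsHighest.removal_eq (hi : IsHighest k q a i) {t : ℕ} {H : ℤ}
    (ht : (rightMove k)^[t] a = withParticle c q H 0) (hc : ∀ y, H - 1 ≤ y → c y = 0) :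
    removeParticle k a = c ∧ shift k a = q * H - t := by
  obtain ⟨h1, h2, h3, h4⟩ := hi.removal
  have hq := hi.pos
  have hk := hi.le
  have hmem : ∀ t, (rightMove k)^[t] a ∈ C k q := fun t => (hi.exists_iterate t).choose_spec.mem
  have hle : breakTime k a ≤ t := by
    by_contra hlt
    have hH := isHighest_withParticle hc hk hq (ht ▸ hmem t)
    have he := endsAt_withParticle hc hq
    have he' : EndsAt (withParticle c q H 0) (endpoint a) := by
      rcases t with _ | t
      · rw [← ht]
        exact endsAt_endpoint hi.ne_zero
      · rw [← ht]
        exact h4 t (by omega)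
    have h5 := h4 t (by omega)
    rw [Function.iterate_succ_apply', ht, hH.endsAt_rightMove he'] at h5
    have := he.unique he'
    omega
  obtain ⟨j, rfl⟩ := Nat.exists_eq_add_of_le hle
  set c' := removeParticle k a
  set h := endpoint a - 1
  -- After the break the free particle makes `j / q` full advances and `j % q` further moves.
  have h5 := iterate_mul_withParticle h2 hk (h1 ▸ hmem _) (j / q)
  have hn0 : (0 : ℤ) ≤ (j / q : ℕ) := Int.natCast_nonneg _
  have h6 := iterate_withParticle (h := h + (j / q : ℕ)) (fun y hy => h2 y (by omega)) hk h5.2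
    (j % q) (by have := Nat.mod_lt j hq; omega)
  have h7 : (rightMove k)^[breakTime k a + j] a = withParticle c' q (h + (j / q : ℕ)) (j % q) := by
    rw [add_comm, Function.iterate_add_apply, h1]
    conv_lhs => rw [← Nat.mod_add_div j q]
    rw [Function.iterate_add_apply, h5.1, h6.1, zero_add]
  have hmod := Nat.mod_lt j hq
  have hdiv := Nat.mod_add_div j q
  generalize hm : j % q = m at *
  generalize hn : j / q = n at *
  have hval : ∀ y, c y + (if y = H then q else 0) =
      c' y + (if y = h + n then q - m else 0) + (if y = h + n + 1 then m else 0) := by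
    intro y
    have h8 := congrArg (fun b => b y) (ht.symm.trans h7)
    simp only [withParticle_apply] at h8
    split_ifs at * <;> omega
  -- If `m > 0`, the last occupied column of the right side is `h + n + 1` and holds `m < q` units.
  -- Comparison with the `q` units in the column `H` on the left excludes this.
  have hm0 : m = 0 := by
    by_contra hm0
    have v1 := hval (h + n + 1)
    have v2 := hval H
    have v3 := h2 (h + n + 1) (by omega)
    have v4 := hc H (by omega)
    have v5 := hc (h + n + 1)
    have v6 := h2 H
    split_ifs at * <;> omega
  have hH : H = h + n := by
    have v1 := hval (h + n)
    have v2 := hval H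
    have v3 := h2 (h + n) (by omega)
    have v4 := hc H (by omega)
    have v5 := hc (h + n)
    have v6 := h2 H
    split_ifs at * <;> omega
  refine ⟨Finsupp.ext fun y => ?_, ?_⟩
  · have := hval y
    split_ifs at * <;> omega
  · rw [h3, hH, ← hdiv, hm0]
    push_cast
    ring

end

/-! ### The configuration as a snapshot of the passage; the vanishing criterion. -/

section

variable {k p q r : ℕ} {a b c d : Configuration} {u D : ℤ → ℤ} {i h e x v : ℤ}

theorem Carrier.eventually_eq_left (h : Carrier k q c u) (hq : q ≤ k) :
    ∃ B : ℤ, ∀ x, x ≤ B → u x = q := by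
  obtain ⟨A, hA⟩ := eventually_zero_left c
  refine ⟨A - 2, fun x hx => ?_⟩
  have h1 := h.tight (x - 1)
  have h2 := h.le x
  have h3 := h.le (x + 1)
  rw [sub_add_cancel, show x - 1 + 2 = x + 1 by ring,
    S_eq_zero (hA _ (by omega)) (hA _ (by omega)),
    L_eq_zero (hA _ (by omega)) (hA _ (by omega)) (hA _ (by omega)) (hA _ (by omega)),
    L_eq_zero (hA _ (by omega)) (hA _ (by omega)) (hA _ (by omega)) (hA _ (by omega))] at h1
  push_cast at h1
  omega

/-- `D x` is the energy at which the particle that passes through `c` enters the column `x`. -/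
structure EntryEnergy (q : ℕ) (u D : ℤ → ℤ) : Prop where
  succ : ∀ y, D (y + 1) = D y + u y
  top : ∃ B, ∀ y, B ≤ y → D y = q * y

theorem Carrier.exists_entryEnergy (h : Carrier k q c u) : ∃ D, EntryEnergy q u D := by
  obtain ⟨B, hB⟩ := h.top
  refine ⟨fun y => q * y + ∑ z ∈ Finset.Ico y B, (q - u z), fun y => ?_, B, fun y hy => ?_⟩
  · rcases le_or_gt B y with hy | hy
    · rw [Finset.Ico_eq_empty (by omega), Finset.Ico_eq_empty (by omega), hB y hy]
      simp
      ring
    · rw [← Finset.insert_Ico_add_one_left_eq_Ico hy, Finset.sum_insert (by simp)]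
      ring
  · rw [Finset.Ico_eq_empty (by omega)]
    simp

theorem EntryEnergy.eq_mul (hD : EntryEnergy q u D) {N : ℤ} (hu : ∀ y, N ≤ y → u y = q) (y : ℤ)
    (hy : N ≤ y) : D y = q * y := by
  revert hy
  refine int_downward_induction (P := fun y => N ≤ y → D y = q * y) ?_ (fun y h1 _ hy => ?_) y
  · obtain ⟨B, hB⟩ := hD.top
    exact ⟨B, fun y hy _ => hB y hy⟩
  · have h2 := h1 (by omega)
    rw [hD.succ, hu y hy] at h2
    linarith

theorem EntryEnergy.mono (hD : EntryEnergy q u D) (hu : ∀ y, 0 ≤ u y) : Monotone D :=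
  monotone_int_of_le_succ fun y => by
    have := hD.succ y
    have := hu y
    omega

/-- `a` is the configuration in which the particle that passes through `c` and leaves `d`
has `v` units to carry from the column `x` to the column `x + 1`. -/
structure Mid (c d : Configuration) (u : ℤ → ℤ) (x v : ℤ) (a : Configuration) : Prop where
  left : ∀ y, y < x → a y = c y
  mid : (a x : ℤ) = c x + v
  mid' : (a (x + 1) : ℤ) = d (x + 1) + u x - v
  right : ∀ y, x + 1 < y → a y = d y

/-- `a` occurs with the energy `s` of the passing particle, as its highest particle. -/
def Occurs (k q : ℕ) (c d : Configuration) (u D : ℤ → ℤ) (a : Configuration) (s : ℤ) : Prop :=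
  ∃ x v, Mid c d u x v a ∧ 1 ≤ v ∧ v ≤ u x ∧ IsHighest k q a x ∧ D (x + 1) - v = s

theorem Pass.occurs_withParticle (hp : Pass k q c d u) (hD : EntryEnergy q u D) (hq : q ≤ k)
    (hq0 : 0 < q) (hc : ∀ y, h - 1 ≤ y → c y = 0) (hm : withParticle c q h 0 ∈ C k q) :
    Occurs k q c d u D (withParticle c q h 0) (q * h) := by
  -- Since `c` admits a full particle in the column `h`, nothing obstructs the incoming particle
  -- before it gets there.
  have hu : ∀ y, h ≤ y → u y = q := by
    intro y hy
    have e0 := hp.at y 0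
    have e1 := hp.le (y + 1)
    have m1 := hm.1 (h - 2)
    have m2 := (hm.2 (h - 3)).1
    simp only [S, withParticle_apply, show h - 2 + 1 = h - 1 by ring, sub_add_cancel,
      show h - 3 + 1 = h - 2 by ring] at m1 m2
    rw [if_neg (by omega), if_neg (by omega), if_neg (by omega), if_neg (by omega),
      hc (h - 1) (by omega), hc h (by omega), if_pos trivial] at m1
    rw [if_neg (by omega), if_neg (by omega), if_neg (by omega), if_neg (by omega)] at m2
    simp only [add_zero, zero_add, Int.reduceSub, S,
      show y + -1 = y - 1 by ring, show y + -2 = y - 2 by ring, show y + -3 = y - 3 by ring,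
      show y - 3 + 1 = y - 2 by ring, show y - 2 + 1 = y - 1 by ring, sub_add_cancel,
      hc y (by omega), hc (y + 1) (by omega), hc (y - 1) (by omega)] at e0
    by_cases h0 : y = h
    · subst h0
      omega
    by_cases h1 : y = h + 1
    · subst h1
      rw [show h + 1 - 2 = h - 1 by ring, show h + 1 - 3 = h - 2 by ring,
        hc (h - 1) (by omega)] at e0
      omega
    · rw [hc (y - 2) (by omega)] at e0
      by_cases h2 : y = h + 2
      · rw [hc (y - 3) (by omega)] at e0
        omega
      · rw [hc (y - 3) (by omega)] at e0
        omega
  refine ⟨h, q, ⟨fun y hy => ?_, ?_, ?_, fun y hy => ?_⟩, by omega, (hu h le_rfl).ge,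
    isHighest_withParticle hc hq hq0 hm, ?_⟩
  · rw [withParticle_apply, if_neg (by omega), if_neg (by omega)]
    rfl
  · rw [withParticle_apply, if_pos rfl, if_neg (by omega)]
    simp
  · have h1 := hp.out (h + 1)
    rw [add_sub_cancel_right, hu _ (by omega), hu _ (by omega)] at h1
    rw [withParticle_apply, if_neg (by omega), if_pos rfl, h1, hu _ le_rfl]
    simp
  · have h1 := hp.out y
    rw [hu _ (by omega), hu _ (by omega)] at h1
    rw [withParticle_apply, if_neg (by omega), if_neg (by omega)]
    omega
  · rw [hD.eq_mul hu _ (by omega)]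
    ring

/-- Undoing a right move advances the leftward passage by one unit. Since the snapshot fixes the
next unit to carry, the point is that the right move was made at that very column. -/
theorem Pass.occurs_of_rightMove (hp : Pass k q c d u) (hD : EntryEnergy q u D) (hq : q ≤ k)
    (ha : IsHighest k q a i) {s : ℤ} (hb : Occurs k q c d u D (rightMove k a) (s + 1)) :
    Occurs k q c d u D a s := by
  obtain ⟨x, v, hM, hv, hvu, hx, hs⟩ := hb
  have hst := ha.step
  have hbC := hx.mem
  set b := rightMove k a
  have hix : i ≤ x := by
    by_contra hlt
    have h1 := hx.lt i (by omega)
    have h2 := hst.S_eq i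
    have h3 := hst.L_eq i
    have h4 := ha.tight
    split_ifs at * <;> omega
  -- Redescribe `b` so that `w < u j`, that is, so that one more unit can be carried into the column
  -- `j`. If `v = u x`, the column `x` is finished, and `j` is the next column to the left with `u j
  -- > 0`, with `w = 0`.
  obtain ⟨j, w, hjx, hw0, hwu, hMj, hDj, hbet⟩ : ∃ j w, j ≤ x ∧ 0 ≤ w ∧ w < u j ∧
      Mid c d u j w b ∧ D (j + 1) - w = s + 1 ∧ ∀ y, j < y → y ≤ x →
        (b y : ℤ) = c y + u y ∧ (b (y + 1) : ℤ) = c (y + 1) + u (y + 1) - u y ∧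
        ∀ z < y, b z = c z := by
    rcases lt_or_eq_of_le hvu with hlt | heq
    · exact ⟨x, v, le_rfl, by omega, hlt, hM, hs, fun y h1 h2 => by omega⟩
    obtain ⟨B, hB⟩ := hp.eventually_eq_left hq
    obtain ⟨j, ⟨hju, hjx⟩, hmax⟩ := Int.exists_greatest_of_bdd (P := fun j => 0 < u j ∧ j < x)
      ⟨x, fun z hz => hz.2.le⟩
      ⟨min B (x - 1), by rw [hB _ (by omega)]; exact_mod_cast ha.pos, by omega⟩
    have hzero : ∀ y, j < y → y < x → u y = 0 := by
      intro y h1 h2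
      by_contra hne
      have h3 := hp.nonneg y
      have h4 := hmax y ⟨by omega, h2⟩
      omega
    have hbet : ∀ y, j < y → y ≤ x →
        (b y : ℤ) = c y + u y ∧ (b (y + 1) : ℤ) = c (y + 1) + u (y + 1) - u y := by
      intro y h1 h2
      rcases lt_or_eq_of_le h2 with h3 | rfl
      · have h4 := hzero y h1 h3
        refine ⟨by rw [hM.left y h3, h4, add_zero], ?_⟩
        rcases lt_or_eq_of_le (show y + 1 ≤ x by omega) with h5 | h5
        · rw [hM.left _ h5, h4, hzero _ (by omega) h5]
          ring
        · rw [h5, hM.mid, h4, heq]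
          ring
      · refine ⟨by rw [hM.mid, heq], ?_⟩
        have h4 := hp.out (y + 1)
        rw [add_sub_cancel_right] at h4
        rw [hM.mid', heq, h4]
        ring
    have hDx : D x = D (j + 1) := by
      refine Int.leInduction (motive := fun y _ => y ≤ x → D y = D (j + 1)) (fun _ => rfl)
        (fun y hy ih hyx => ?_) x (show j + 1 ≤ x by omega) le_rfl
      rw [hD.succ, ih (by omega), hzero y (by omega) (by omega), add_zero]
    refine ⟨j, 0, hjx.le, le_rfl, hju, ⟨fun y hy => hM.left y (by omega), ?_, ?_, fun y hy => ?_⟩,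
      ?_, fun y h1 h2 => ⟨(hbet y h1 h2).1, (hbet y h1 h2).2, fun z hz => hM.left z (by omega)⟩⟩
    · rw [hM.left j hjx, add_zero]
    · have h1 := (hbet (j + 1) (by omega) (by omega)).1
      have h2 := hp.out (j + 1)
      rw [add_sub_cancel_right] at h2
      omega
    · rcases le_or_gt y x with hyx | hyx
      · have h1 := (hbet y (by omega) hyx).1
        have h2 := hp.out y
        rw [hzero (y - 1) (by omega) (by omega)] at h2
        omega
      · rcases eq_or_ne y (x + 1) with rfl | hne
        · have h1 := hM.mid'
          omega
        · exact hM.right y (by omega)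
    · have h1 := hD.succ x
      omega
  have hD1 : i = j → Occurs k q c d u D a s := by
    rintro rfl
    refine ⟨i, w + 1, ⟨fun y hy => ?_, ?_, ?_, fun y hy => ?_⟩, by omega, by omega, ha, by omega⟩
    · have h1 := hst y
      have h2 := hMj.left y hy
      split_ifs at * <;> omega
    · have h1 := hst i
      have h2 := hMj.mid
      split_ifs at * <;> omega
    · have h1 := hst (i + 1)
      have h2 := hMj.mid'
      split_ifs at * <;> omega
    · have h1 := hst y
      have h2 := hMj.right y hy
      split_ifs at * <;> omega
  rcases lt_trichotomy i j with hij | hij | hij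
  -- If `i < j`, then `b` is tight at `j` because the carrier is tight at `j + 1`, while `a` is not.
  -- So the move must have raised `S` or `L` at `j`, which leaves `j = i + 1` or `j = i + 2`; then
  -- `i = j - 1` or `i = j - 2` conflicts with the slack of `b` near there.
  · exfalso
    have hout := hp.out (j + 1)
    have hout' := hp.out (j + 2)
    have m0 := hMj.mid
    have m1 := hMj.mid'
    have m2 := hMj.left (j - 1) (by omega)
    have m3 := hMj.left (j - 2) (by omega)
    have m4 := hMj.left (j - 3) (by omega)
    have m5 := hMj.right (j + 2) (by omega)
    have t0 := hp.tight j
    have t1 := hp.le_L (j - 1)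
    have t2 := hp.le_S (j - 1)
    have t3 := hp.le_L (j - 2)
    have n0 := hp.nonneg (j - 1)
    have s0 := hst.S_eq j
    have s1 := hst.L_eq j
    have s2 := hst.S_eq i
    have s3 := hst.L_eq i
    have a0 := ha.lt j hij
    have a1 := ha.tight
    have b0 := hbC.1 (j - 1)
    have b1 := (hbC.2 (j + 1)).1
    rw [add_sub_cancel_right] at hout
    rw [show j + 2 - 1 = j + 1 by ring] at hout'
    rw [sub_add_cancel, show j - 1 + 2 = j + 1 by ring] at b0 t1
    rw [show j - 2 + 1 = j - 1 by ring, sub_add_cancel] at t3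
    rw [sub_add_cancel] at t2
    have hSj : (S b j : ℤ) = S c j + u (j + 1) := by
      simp only [S]
      push_cast
      omega
    have hLj : (L b j : ℤ) = L c j + u (j + 1) + u (j + 2) := by
      simp only [L]
      push_cast
      omega
    have hS1 : (S b (j - 1) : ℤ) < q := by
      simp only [S, sub_add_cancel] at t2 ⊢
      push_cast at t2 ⊢
      omega
    have hL1 : (L b (j - 1) : ℤ) < k + q := by
      simp only [L, sub_add_cancel, show j - 1 - 1 = j - 2 by ring, show j - 1 + 2 = j + 1 by ring]
        at t1 ⊢
      push_cast at t1 ⊢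
      omega
    have hL2 : (L b (j - 2) : ℤ) < k + q := by
      simp only [L, sub_add_cancel, show j - 2 - 1 = j - 3 by ring, show j - 2 + 1 = j - 1 by ring]
        at t3 ⊢
      push_cast at t3 ⊢
      omega
    have htight : S b j = q ∨ L b j = k + q := by omega
    have hcases : j = i + 1 ∨ j = i + 2 := by
      clear hD1
      split_ifs at s0 s1 <;> omega
    rcases hcases with rfl | rfl
    · rw [if_neg (by omega), if_neg (by omega)] at s2 s3
      rw [add_sub_cancel_right] at hS1 hL1
      omega
    · rw [if_neg (by omega), if_neg (by omega)] at s2 s3 s0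
      rw [add_sub_cancel_right] at hL2
      have h1 : S b i = q := by omega
      have h2 : L b (i + 2) = k + q := by omega
      simp only [S, L, show i + 2 - 1 = i + 1 by ring, add_assoc, Int.reduceAdd]
        at h1 h2 hL1 b0 b1
      push_cast at hL1
      rw [add_sub_cancel_right] at hL1
      omega
  · exact hD1 hij
  -- If `j < i ≤ x`, then `a` has one unit more than `c i + u i` in the column `i`. All three
  -- constraints on `u i` are then strict, against tightness.
  · exfalso
    obtain ⟨h1, h2, h3⟩ := hbet i hij hix
    have m1 := h3 (i - 1) (by omega)
    have m2 := h3 (i - 2) (by omega)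
    have m3 := h3 (i - 3) (by omega)
    have t0 := hp.tight (i - 1)
    have a0 := hst i
    have a1 := hst (i - 1)
    have a2 := hst (i - 2)
    have a3 := hst (i - 3)
    have a4 := hst (i + 1)
    have b0 := (ha.mem.2 (i - 1)).1
    have b1 := (ha.mem.2 (i - 1)).2
    have b2 := (ha.mem.2 (i - 2)).2
    rw [if_neg (by omega), if_neg (by omega)] at a1 a2 a3
    rw [if_neg (by omega), if_pos rfl] at a0
    rw [if_pos rfl, if_neg (by omega)] at a4
    simp only [S, L, sub_add_cancel, show i - 1 - 1 = i - 2 by ring, show i - 2 - 1 = i - 3 by ring,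
      show i - 2 + 1 = i - 1 by ring, show i - 1 + 2 = i + 1 by ring] at t0 b0 b1 b2
    push_cast at t0
    omega

theorem Pass.occurs (hp : Pass k q c d u) (hD : EntryEnergy q u D) (hq : q ≤ k) (t : ℕ) {s : ℤ} :
    ∀ {a i}, IsHighest k q a i → Occurs k q c d u D ((rightMove k)^[t] a) s →
      Occurs k q c d u D a (s - t) := by
  induction t with
  | zero => intro a i _ h; simpa using h
  | succ t ih =>
    intro a i ha h
    obtain ⟨j, -, hj⟩ := ha.exists_rightMove
    refine hp.occurs_of_rightMove hD hq ha ?_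
    have := ih hj h
    push_cast
    rwa [show s - (t + 1) + 1 = s - (t : ℤ) by ring]

/-- An empty column `y + 1` of `d` means `u y = c (y + 1) + u (y + 1)`, so the full load `q` is
handed on. -/
theorem Pass.eq_of_vanishing (hp : Pass k q c d u) {N : ℤ} (hd : ∀ y, N < y → d y = 0) (y : ℤ)
    (hy : N ≤ y) : u y = q := by
  revert hy
  refine int_downward_induction (P := fun y => N ≤ y → u y = q) ?_ (fun y h1 _ hy => ?_) y
  · obtain ⟨B, hB⟩ := hp.top
    exact ⟨B, fun y hy _ => hB y hy⟩
  · have h2 := h1 (by omega)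
    have h3 := hp.out (y + 1)
    have h4 := hd (y + 1) (by omega)
    have h5 := hp.le y
    rw [add_sub_cancel_right] at h3
    omega

/-- A configuration vanishes above `N` if and only if its highest particle has an energy of at most
`q * N` and what it leaves when it passes to the far left vanishes above `N`. -/
theorem IsHighest.vanishing_iff (ha : IsHighest k q a i) (hp : Pass k q (removeParticle k a) d u)
    (N : ℤ) : (∀ y, N < y → a y = 0) ↔ shift k a ≤ q * N ∧ ∀ y, N < y → d y = 0 := by
  have hq := ha.le
  have hq0 : (0 : ℤ) < q := by exact_mod_cast ha.pos
  obtain ⟨D, hD⟩ := hp.exists_entryEnergy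
  obtain ⟨h1, h2, h3, -⟩ := ha.removal
  have hocc : Occurs k q (removeParticle k a) d u D a (shift k a) := by
    rw [h3]
    refine hp.occurs hD hq _ ha ?_
    rw [h1]
    obtain ⟨j, hj⟩ := ha.exists_iterate (breakTime k a)
    exact hp.occurs_withParticle hD hq ha.pos h2 (h1 ▸ hj.mem)
  obtain ⟨x, v, hM, hv, hvu, hx, hs⟩ := hocc
  constructor
  · intro haN
    have hxN : x ≤ N := by
      by_contra hlt
      have := haN x (by omega)
      have := hM.mid
      omega
    have hdN : ∀ y, N < y → d y = 0 := by
      intro y hy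
      have h4 := haN y hy
      by_cases hyx : y = x + 1
      · subst hyx
        have := hM.mid'
        omega
      · rw [← hM.right y (by omega), h4]
    refine ⟨?_, hdN⟩
    have hu := hp.eq_of_vanishing hdN
    by_cases hxN' : x = N
    · subst hxN'
      have h4 := haN (x + 1) (by omega)
      have h5 := hM.mid'
      have h6 := hu x le_rfl
      rw [hD.eq_mul hu _ (by omega)] at hs
      linarith [h5, h6, h4, Int.natCast_nonneg (d (x + 1)), (by exact_mod_cast h4 : (a (x + 1) : ℤ) = 0)]
    · have h4 := hD.mono hp.nonneg (show x + 1 ≤ N by omega)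
      rw [hD.eq_mul hu N le_rfl] at h4
      omega
  · rintro ⟨hsN, hdN⟩ y hy
    have hu := hp.eq_of_vanishing hdN
    by_cases hxN : x + 1 ≤ N
    · rw [hM.right y (by omega), hdN y hy]
    · have h4 := hu x (by omega)
      rw [hD.eq_mul hu _ (by omega)] at hs
      have h5 : (q : ℤ) * x ≤ q * N := by
        linarith
      have h6 := le_of_mul_le_mul_left h5 hq0
      have h7 : x = N := by omega
      subst h7
      have h8 : v = q := by linarith
      by_cases hyx : y = x + 1
      · subst hyx
        have h9 := hM.mid'
        have := hdN (x + 1) hy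
        omega
      · rw [hM.right y (by omega), hdN y hy]

end

/-! ### Collision of two particles, shift of the riggings, and the induction. -/

section

variable {k p q r : ℕ} {a b c d : Configuration} {u D : ℤ → ℤ} {i h e x v : ℤ}

/-- The collision far from everything else. The lighter particle advances by two columns and `p + q
- k` further units, where the truncated subtraction is the `max` in `A`; its energy grows by `2 p +
max (p + q - k) 0`. -/
theorem Pass.add_withParticle (hp : Pass k q c d u) (hpq : p ≤ q) (hq : q ≤ k) {H : ℤ}
    (hc : ∀ y, H - 5 ≤ y → c y = 0) (hu : ∀ y, H - 5 ≤ y → u y = q) :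
    ∃ u', Pass k q (withParticle c p H 0) (withParticle d p (H + 2) (p + q - k)) u' := by
  obtain ⟨r, hr⟩ : ∃ r, r = p + q - k := ⟨_, rfl⟩
  rw [← hr]
  have hd : ∀ y, H - 4 ≤ y → d y = 0 := by
    intro y hy
    have h1 := hp.out y
    rw [hc y (by omega), hu y (by omega), hu (y - 1) (by omega)] at h1
    omega
  have hS : ∀ y, S (Conf.withParticle c p H 0) y = S c y + if y = H - 1 ∨ y = H then p else 0 := by
    intro y
    simp only [S, withParticle_apply]
    split_ifs <;> omega
  have hL : ∀ y, L (Conf.withParticle c p H 0) y = L c y +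
      if y = H - 1 ∨ y = H then 2 * p else if y = H - 2 ∨ y = H + 1 then p else 0 := by
    intro y
    simp only [Conf.L_eq, hS]
    split_ifs <;> omega
  have hS0 : ∀ y, H - 5 ≤ y → S c y = 0 := fun y hy => S_eq_zero (hc _ hy) (hc _ (by omega))
  have hL0 : ∀ y, H - 4 ≤ y → L c y = 0 := fun y hy =>
    L_eq_zero (hc _ (by omega)) (hc _ (by omega)) (hc _ (by omega)) (hc _ (by omega))
  refine ⟨fun y => u y - (if y = H ∨ y = H + 1 then p else if y = H + 2 then r else 0 : ℕ),
    ⟨fun y => ?_, ?_, fun y => ?_, fun y => ?_, fun y => ?_⟩, fun y => ?_⟩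
  · rcases lt_or_ge y H with hy | hy
    · rw [if_neg (by omega), if_neg (by omega)]
      simpa using hp.nonneg y
    · rw [hu y (by omega)]
      split_ifs <;> omega
  · refine ⟨H + 3, fun y hy => ?_⟩
    rw [if_neg (by omega), if_neg (by omega), hu y (by omega)]
    simp
  · rcases lt_or_ge y (H - 2) with hy | hy
    · rw [hS, if_neg (by omega), if_neg (by omega), if_neg (by omega)]
      simpa using hp.le_S y
    · rw [hS, hS0 y (by omega), hu _ (by omega)]
      split_ifs <;> omega
  · rcases lt_or_ge y (H - 3) with hy | hy
    · rw [hL, if_neg (by omega), if_neg (by omega), if_neg (by omega), if_neg (by omega),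
        if_neg (by omega), if_neg (by omega)]
      simpa using hp.le_L y
    · rw [hL, hL0 y (by omega), hu _ (by omega), hu _ (by omega)]
      split_ifs <;> omega
  · rcases lt_or_ge y (H - 3) with hy | hy
    · rw [hL, hL, hS, if_neg (by omega), if_neg (by omega), if_neg (by omega), if_neg (by omega),
        if_neg (by omega), if_neg (by omega), if_neg (by omega), if_neg (by omega),
        if_neg (by omega)]
      simpa using hp.tight y
    · rw [hL, hL, hS, hS0 y (by omega), hL0 y (by omega), hL0 (y - 1) (by omega), hu _ (by omega),
        hu _ (by omega)]
      split_ifs <;> omega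
  · have h1 := hp.out y
    rw [withParticle_apply, withParticle_apply]
    push_cast
    split_ifs <;> omega

/-- The passage of a heavier particle leaves the removal of the highest particle unchanged, up to
a shift of its energy. -/
theorem Pass.removal (hp : Pass k q c d u) (hc : IsHighest k p c i) (hpq : p ≤ q) (hq : q ≤ k) :
    (∃ u', Pass k q (removeParticle k c) (removeParticle k d) u') ∧
      Conf.shift k d = Conf.shift k c + A k q p ∧ ∃ j, IsHighest k p d j := by
  obtain ⟨⟨j, hd⟩, -⟩ := hp.exists_rightMove hc hpq hq
  obtain ⟨h1, h2, h3, -⟩ := hc.removal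
  have hmem : ∀ t, (rightMove k)^[t] c ∈ C k p := fun t => (hc.exists_iterate t).choose_spec.mem
  have hmem' : ∀ t, (rightMove k)^[t] d ∈ C k p := fun t => (hd.exists_iterate t).choose_spec.mem
  have hcC : removeParticle k c ∈ C k q := by
    refine C_mono hpq (C_of_le (h1 ▸ hmem _) fun y => ?_)
    rw [withParticle_apply]
    omega
  obtain ⟨d', u', hp'⟩ := exists_pass hcC hq
  obtain ⟨B, hB⟩ := hp'.top
  set h := endpoint c - 1
  set t := breakTime k c
  obtain ⟨n, hn⟩ : ∃ n : ℕ, max B h + 10 ≤ h + n := ⟨(max B h + 10 - h).toNat, by omega⟩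
  have h4 := (iterate_mul_withParticle h2 hc.le (h1 ▸ hmem _) n).1
  rw [← h1, ← Function.iterate_add_apply] at h4
  obtain ⟨u₁, hp₁⟩ := hp.exists_iterate hc hpq hq (p * n + t)
  obtain ⟨u₂, hp₂⟩ := hp'.add_withParticle hpq hq (H := h + n) (fun y hy => h2 y (by omega))
    (fun y hy => hB y (by omega))
  rw [h4] at hp₁
  have h5 := hp₁.unique hp₂
  have hd0 : ∀ y, h + n - 4 ≤ y → d' y = 0 := by
    intro y hy
    have h1 := hp'.out y
    rw [h2 y (by omega), hB y (by omega), hB (y - 1) (by omega)] at h1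
    omega
  have hr : p + q - k ≤ p := by omega
  -- The particle in `d` may straddle two columns. Further right moves gather it in the column `h +
  -- n + 3`, as `IsHighest.removal_eq` requires.
  have h6 := (iterate_withParticle (h := h + n + 2) (r := p + q - k) (fun y hy => hd0 y (by omega))
    hc.le (h5 ▸ hmem' _) (p - (p + q - k)) (by omega)).1
  rw [← h5, Nat.add_sub_cancel' hr, withParticle_self, ← Function.iterate_add_apply] at h6
  obtain ⟨h7, h8⟩ := hd.removal_eq h6 (fun y hy => hd0 y (by omega))
  refine ⟨⟨u', h7 ▸ hp'⟩, ?_, j, hd⟩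
  rw [h8, h3, A, min_eq_right (by omega)]
  push_cast [hr]
  rcases le_total (k : ℤ) (p + q) with hk | hk
  · rw [max_eq_left (by omega), Nat.cast_sub (by omega)]
    push_cast
    ring
  · rw [max_eq_right (by omega), Nat.sub_eq_zero_of_le (by omega)]
    push_cast
    ring

theorem size_add (a b : Configuration) : size (a + b) = size a + size b := by
  have := total_add (fun _ => 1) a b
  rw [total_one, total_one, total_one] at this
  exact_mod_cast this

theorem size_single (i : ℤ) (n : ℕ) : size (Finsupp.single i n) = n := by
  simp [size]

theorem IsHighest.size_iterate (hi : IsHighest k q a i) (t : ℕ) :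
    size ((rightMove k)^[t] a) = size a := by
  induction t with
  | zero => rfl
  | succ t ih =>
    obtain ⟨j, hj⟩ := hi.exists_iterate t
    have h2 := hj.step.total_eq fun _ => 1
    rw [total_one, total_one] at h2
    rw [Function.iterate_succ_apply']
    omega

theorem IsHighest.size_removeParticle (hi : IsHighest k q a i) :
    size (removeParticle k a) + q = size a := by
  rw [← hi.size_iterate (breakTime k a), hi.removal.1, Conf.withParticle, size_add, size_add,
    size_single, size_single]
  omega

theorem IsHighest.removeParticle_mem (hi : IsHighest k q a i) : removeParticle k a ∈ C k q := by
  obtain ⟨j, hj⟩ := hi.exists_iterate (breakTime k a)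
  refine C_of_le (hi.removal.1 ▸ hj.mem) fun y => ?_
  rw [withParticle_apply]
  omega

theorem eq_zero_of_size (h : size a = 0) : a = 0 := by
  ext x
  by_contra hx
  have h1 : a x ≤ size a := by
    rw [size, Finsupp.sum]
    exact Finset.single_le_sum (f := fun i => a i) (fun _ _ => Nat.zero_le _)
      (Finsupp.mem_support_iff.2 hx)
  simp only [Finsupp.coe_zero, Pi.zero_apply] at hx
  omega

theorem iotaAux_eq (n m : ℕ) (a : Configuration) (ha : a ∈ Adm k) (hn : size a ≤ n)
    (hm : size a ≤ m) : iotaAux k n a = iotaAux k m a := by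
  induction n generalizing m a with
  | zero =>
    obtain rfl := eq_zero_of_size (Nat.le_zero.1 hn)
    cases m <;> simp [iotaAux]
  | succ n ih =>
    by_cases h0 : a = 0
    · subst h0
      cases m <;> simp [iotaAux]
    · obtain ⟨q, i, hi⟩ := exists_isHighest ha h0
      have h1 := hi.size_removeParticle
      have h2 := hi.pos
      obtain ⟨m, rfl⟩ : ∃ m', m = m' + 1 := ⟨m - 1, by omega⟩
      simp only [iotaAux, if_neg h0]
      rw [ih m _ hi.removeParticle_mem.1 (by omega) (by omega)]

theorem iota_zero : iota k 0 = [] := by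
  simp [iota, size, iotaAux]

theorem IsHighest.iota_eq (hi : IsHighest k q a i) : iota k a =
    (q, shift k a - ((iota k (removeParticle k a)).map fun x => A k q x.1).sum) ::
      iota k (removeParticle k a) := by
  have h1 := hi.size_removeParticle
  have h2 := hi.pos
  obtain ⟨n, hn⟩ : ∃ n, size a = n + 1 := ⟨size a - 1, by omega⟩
  rw [iota, hn]
  simp only [iotaAux, if_neg hi.ne_zero, hi.weight_eq]
  rw [iotaAux_eq n (size (removeParticle k a)) _ hi.removeParticle_mem.1 (by omega) le_rfl]
  rfl

/-- The passage of a particle of weight `q` keeps the particle content and shifts the riggings. -/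
theorem Pass.iota_eq (hp : Pass k q c d u) (hc : c ∈ C k q) (hq : q ≤ k) :
    iota k d = (iota k c).map fun x => (x.1, x.2 + A k q x.1) := by
  induction hn : size c using Nat.strong_induction_on generalizing c d u with
  | _ n ih =>
    by_cases h0 : c = 0
    · subst h0
      have h1 : Pass k q 0 0 fun _ => q :=
        ⟨⟨by simp, ⟨0, by simp⟩, by simp [S], by simpa [L] using hq, by simp [S]⟩, by simp⟩
      rw [hp.unique h1, iota_zero]
      rfl
    · obtain ⟨p, i, hi⟩ := exists_isHighest hc.1 h0
      have hpq : p ≤ q := hi.weight_eq ▸ Nat.sInf_le hc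
      obtain ⟨⟨u', hp'⟩, h1, j, hj⟩ := hp.removal hi hpq hq
      have h2 := hi.size_removeParticle
      have h3 := hi.pos
      rw [hi.iota_eq, hj.iota_eq,
        ih _ (by omega) hp' (C_mono hpq hi.removeParticle_mem) rfl, h1]
      simp only [List.map_cons, List.map_map, Function.comp_def, List.cons.injEq, Prod.mk.injEq,
        true_and, and_true]
      ring

/-- The bounds on the riggings, written with the terms `j = i` included. -/
theorem vanishing_iff_iota (R : List (ℕ × ℤ)) (ha : a ∈ Adm k) (hR : iota k a = R) (N : ℤ) :
    (∀ y, N < y → a y = 0) ↔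
      ∀ x ∈ R, x.2 + (R.map fun y => A k x.1 y.1).sum ≤ x.1 * N + A k x.1 x.1 := by
  induction hn : R.length generalizing a R with
  | zero =>
    by_cases h0 : a = 0
    · obtain rfl := List.length_eq_zero_iff.1 hn
      simp [h0]
    · obtain ⟨q, i, hi⟩ := exists_isHighest ha h0
      rw [hi.iota_eq] at hR
      simp [← hR] at hn
  | succ n ih =>
    have h0 : a ≠ 0 := by
      rintro rfl
      rw [iota_zero] at hR
      simp [← hR] at hn
    obtain ⟨q, i, hi⟩ := exists_isHighest ha h0
    have hmem := hi.removeParticle_mem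
    -- The induction hypothesis is used for this `d`, whose list of riggings is that of the
    -- remaining particles shifted by `A k q`.
    obtain ⟨d, u, hp⟩ := exists_pass hmem hi.le
    have hd := hp.iota_eq hmem hi.le
    rw [hi.iota_eq] at hR
    subst hR
    rw [hi.vanishing_iff hp N, ih _ (hp.mem hmem hi.le).1 hd (by simpa using hn)]
    generalize iota k (removeParticle k a) = R
    simp only [List.forall_mem_cons, List.forall_mem_map, List.map_cons, List.sum_cons,
      List.map_map, Function.comp_def]
    refine and_congr ⟨fun h => by linarith, fun h => by linarith⟩ (forall₂_congr fun x _ => ?_)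
    have hcomm : A k q x.1 = A k x.1 q := by
      rw [A, A, min_comm, add_comm (q : ℤ)]
    rw [hcomm]
    exact ⟨fun h => by linarith, fun h => by linarith⟩

end

end Conf

theorem mainTheorem7 (k l : ℕ) (hlk : l ≤ k) (N : ℤ) (a : Conf.Configuration)
    (ha : a ∈ Conf.Cpos k l) :
    a ∈ Conf.CposUpTo k l N ↔
      ∀ i : Fin (Conf.numParts k a),
        Conf.rigging k a i ≤ (Conf.part k a i : ℤ) * N
          - ∑ j ∈ Finset.univ.erase i, Conf.A k (Conf.part k a i) (Conf.part k a j) := by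
  have h1 : a ∈ Conf.CposUpTo k l N ↔ ∀ y, N < y → a y = 0 := ⟨fun h => h.2, fun h => ⟨ha, h⟩⟩
  rw [h1, Conf.vanishing_iff_iota _ ha.1.1 rfl N, List.forall_mem_iff_get]
  refine forall_congr' fun (i : Fin (Conf.numParts k a)) => ?_
  have h2 : ((Conf.iota k a).map fun y => Conf.A k (Conf.part k a i) y.1).sum =
      ∑ j, Conf.A k (Conf.part k a i) (Conf.part k a j) := by
    rw [← Fin.sum_univ_getElem, ← Equiv.sum_comp (finCongr (List.length_map ..).symm)]
    simp only [finCongr_apply, Fin.val_cast, List.getElem_map]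
    rfl
  change Conf.rigging k a i + ((Conf.iota k a).map fun y => Conf.A k (Conf.part k a i) y.1).sum ≤
    Conf.part k a i * N + Conf.A k (Conf.part k a i) (Conf.part k a i) ↔ _
  -- The term `j = i` stands on both sides of the list form of the bound and cancels once it is
  -- split off.
  rw [h2, ← Finset.add_sum_erase _ _ (Finset.mem_univ i)]
  exact ⟨fun h => by linarith, fun h => by linarith⟩
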